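/- Let $m$ be a positive integer and let $W_m$ be the hyperoctahedral group, i.e. the group of permutations $w$ of $\{\pm1,\dots,\pm m\}$ with $w(-a)=-w(a)$; $S_m$ is the subgroup of those $w$ with $w([m])=[m]$, where $[m]=\{1,\dots,m\}$. Let $\ell$ be the Coxeter length on $W_m$ for the generators $t_1,s_1,\dots,s_{m-1}$, where $t_1$ changes the sign of $1$ and $s_i$ interchanges $i$ and $i+1$. A signed composition of $m$ is a tuple $p=(p_1,\dots,p_k)$ of nonzero integers with $\sum_i|p_i|=m$; its blocks are the consecutive intervals $P_1,\dots,P_k$ of $[m]$ with $|P_i|=|p_i|$. Put $$W_p=\{w\in W_m \mid w(P_i)\subseteq \pm P_i \text{ for all } i,\ \text{and } w(P_i)\subseteq P_i \text{ if } p_i<0\},$$ let $X_p$ be the set of elements of minimal length in the left cosets $wW_p$, and let $x_p=\sum_{w\in X_p}w\in\mathbb C W_m$. Let $\Sigma(W_m)$ be the span of the $x_p$ (the Mantaci--Reutenauer algebra). The elements $x_p$ are linearly independent, so there is a unique linear map $\theta_m$ from $\Sigma(W_m)$ to the algebra of complex class functions on $W_m$ with $\theta_m(x_p)=\operatorname{Ind}_{W_p}^{W_m}(1_{W_p})$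 for every signed composition $p$ of $m$. For $w\in S_m$ let $D(w)=\{i\in[m-1]\mid w(i)>w(i+1)\}$, and let $$r_m=\sum_{A\subseteq[m-1]}\frac{(-1)^{|A|}}{|A|+1}\sum_{\substack{w\in S_m\\ D(w)\subseteq A}}w .$$ Let $\epsilon_m^{\pm}=\tfrac12(\mathrm{id}\pm w_{0,m})$, where $w_{0,m}(a)=-a$. Let $u_{(m)}$ and $u_{(\overline m)}$ be the characteristic functions of the conjugacy classes in $W_m$ of $w_{(m)}$ and $w_{(\overline m)}$ respectively. Here $w_{(m)}=(1\;2\;\cdots\;m)$ is the positive $m$-cycle, while $w_{(\overline m)}$ is $(1\;2\;\cdots\;m)\,w_{0,m}$ if $m$ is odd and, if $m$ is even, the negative $m$-cycle with $j\mapsto j+1$ for $j<m$ and $m\mapsto -1$. Then $r_m$, $\epsilon_m^+r_m$ and $\epsilon_m^-r_m$ lie in $\Sigma(W_m)$, and $$\theta_m(r_m)=u_{(m)}+u_{(\overline m)},$$ $$\theta_m(\epsilon_m^+r_m)=\begin{cases}u_{(m)}&\text{if } m \text{ is odd}\\ u_{(\overline m)}&\text{if } m\text{ is even,}\end{cases}\qquad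 \theta_m(\epsilon_m^-r_m)=\begin{cases}u_{(m)}&\text{if } m \text{ is even}\\ u_{(\overline m)}&\text{if } m\text{ is odd.}\end{cases}$$ -/

import Mathlib

noncomputable section

namespace Hyperoctahedral

/-- The set `{1, …, n} ⨿ {-1, …, -n}`: the pair `(i, ε)` stands for the signed integer
`ε * (i + 1)`. -/
abbrev SignedPoint (n : ℕ) : Type := Fin n × ℤˣ

/-- The additive inverse `a ↦ -a` on `{1, …, n} ⨿ {-1, …, -n}`. -/
def bar {n : ℕ} (a : SignedPoint n) : SignedPoint n := (a.1, -a.2)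

/-- The signed permutations of `n`, as a subgroup of the group of permutations of
`{1, …, n} ⨿ {-1, …, -n}`. -/
def signedPerms (n : ℕ) : Subgroup (Equiv.Perm (SignedPoint n)) where
  carrier := {w | ∀ a, w (bar a) = bar (w a)}
  mul_mem' := by
    intro u v hu hv a
    simp only [Set.mem_ofPred_eq] at hu hv
    simp [Equiv.Perm.mul_apply, hu, hv]
  one_mem' := by
    intro a
    rfl
  inv_mem' := by
    intro w hw a
    simp only [Set.mem_ofPred_eq] at hw
    rw [Equiv.Perm.inv_eq_iff_eq, hw]
    simp

/-- The hyperoctahedral group `W_n`. -/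
abbrev W (n : ℕ) : Type := ↥(signedPerms n)

/-- The signed permutation `i ↦ s i * σ i`, `-i ↦ -(s i * σ i)`. -/
def ofPermSign {n : ℕ} (σ : Equiv.Perm (Fin n)) (s : Fin n → ℤˣ) : W n :=
  ⟨{ toFun := fun a => (σ a.1, s a.1 * a.2)
     invFun := fun a => (σ.symm a.1, s (σ.symm a.1) * a.2)
     left_inv := by
       intro a
       simp [← mul_assoc]
     right_inv := by
       intro a
       simp [← mul_assoc] }, by
    intro a
    simp [bar]⟩

/-- The embedding of the symmetric group `S_n` in `W_n`. -/
def ofPerm {n : ℕ} (σ : Equiv.Perm (Fin n)) : W n := ofPermSign σ 1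

/-- The Coxeter generators `t_1, s_1, …, s_{n-1}` of `W_n`: `t_1` changes the sign of the first
point, `s_i` interchanges the neighbours `i` and `i + 1` (and `-i` and `-(i + 1)`). -/
def simpleReflections (n : ℕ) : Set (W n) :=
  {w | (∃ h : 0 < n, w = ofPermSign 1 (Function.update 1 ⟨0, h⟩ (-1))) ∨
    ∃ (i : ℕ) (h : i + 1 < n),
      w = ofPerm (Equiv.swap ⟨i, Nat.lt_of_succ_lt h⟩ ⟨i + 1, h⟩)}

/-- The Coxeter length: the least length of a word in the Coxeter generators with product `w`. -/
def length {n : ℕ} (w : W n) : ℕ :=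
  sInf {k | ∃ l : List (W n), (∀ g ∈ l, g ∈ simpleReflections n) ∧ l.prod = w ∧ l.length = k}

/-- A signed composition of `n`: a tuple of nonzero integers whose absolute values sum to `n`. -/
structure SignedComposition (n : ℕ) where
  parts : List ℤ
  ne_zero : ∀ a ∈ parts, a ≠ 0
  sum_natAbs : (parts.map Int.natAbs).sum = n

namespace SignedComposition

variable {n : ℕ} (p : SignedComposition n)

/-- The partial sum `|p_1| + ⋯ + |p_i|`. -/
def partialSum (i : ℕ) : ℕ := ((p.parts.take i).map Int.natAbs).sum

/-- The blocks of `p`. Both the parts and the points of `Fin n` are numbered from `0`, so block `i`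
consists of the `j` with `|p_1| + ⋯ + |p_i| ≤ j < |p_1| + ⋯ + |p_{i+1}|`. -/
def block (i : Fin p.parts.length) : Set (Fin n) :=
  {j | p.partialSum i ≤ (j : ℕ) ∧ (j : ℕ) < p.partialSum (i + 1)}

/-- The signed Young subgroup `W_p`: all `w` with `w(P_i) ⊆ ±P_i` for every block `P_i`, and
`w(P_i) ⊆ P_i` if `p_i < 0`. -/
def youngSubgroup : Subgroup (W n) :=
  let M : Submonoid (W n) :=
    { carrier := {w | ∀ i : Fin p.parts.length, ∀ j ∈ p.block i,
        (w.1 (j, 1)).1 ∈ p.block i ∧ (p.parts[i] < 0 → (w.1 (j, 1)).2 = 1)}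
      one_mem' := by
        intro i j hj
        exact ⟨hj, fun _ => rfl⟩
      mul_mem' := by
        intro u v hu hv i j hj
        obtain ⟨h1, h2⟩ := hv i j hj
        obtain ⟨h3, h4⟩ := hu i _ h1
        have key : (u * v).1 (j, 1) = u.1 ((v.1 (j, 1)).1, (v.1 (j, 1)).2) := rfl
        rw [key]
        rcases Int.units_eq_one_or (v.1 (j, 1)).2 with h | h
        · rw [h]
          exact ⟨h3, h4⟩
        · have hb := u.2 ((v.1 (j, 1)).1, 1)
          simp only [bar] at hb
          rw [h, hb]
          refine ⟨h3, fun hneg => ?_⟩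
          rw [h2 hneg] at h
          exact absurd h (by decide) }
  { M with
    inv_mem' := by
      intro w hw
      have h : w⁻¹ = w ^ (orderOf w - 1) := by
        rw [inv_eq_iff_mul_eq_one, ← pow_succ',
          Nat.sub_add_cancel (orderOf_pos w), pow_orderOf_eq_one]
      rw [h]
      exact M.pow_mem hw _ }

/-- The set `X_p` of elements of minimal length in their left coset `w W_p`. -/
def minimalCosetReps : Set (W n) :=
  {w | ∀ v ∈ p.youngSubgroup, length w ≤ length (w * v)}

/-- The element `x_p`, the sum in `ℂ W_n` of the elements of `X_p`. -/
def x : MonoidAlgebra ℂ (W n) :=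
  ∑ w ∈ p.minimalCosetReps.toFinite.toFinset, MonoidAlgebra.single w 1

end SignedComposition

/-- The Mantaci-Reutenauer algebra `Σ(W_n)`, as a subspace of `ℂ W_n`: the span of the elements
`x_p` for `p` a signed composition of `n`. -/
def mantaciReutenauer (n : ℕ) : Submodule ℂ (MonoidAlgebra ℂ (W n)) :=
  Submodule.span ℂ (Set.range (SignedComposition.x (n := n)))

theorem x_mem {n : ℕ} (p : SignedComposition n) : p.x ∈ mantaciReutenauer n :=
  Submodule.subset_span ⟨p, rfl⟩

/-- The algebra of complex-valued class functions on a group. -/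
def classFunctions (G : Type*) [Group G] : Subalgebra ℂ (G → ℂ) where
  carrier := {f | ∀ g h : G, f (h * g * h⁻¹) = f g}
  mul_mem' := by
    intro a b ha hb g h
    simp [ha g h, hb g h]
  add_mem' := by
    intro a b ha hb g h
    simp [ha g h, hb g h]
  algebraMap_mem' := by
    intro r g h
    rfl

/-- The characteristic function of the conjugacy class of `g`. -/
def classIndicator {G : Type*} [Group G] (g : G) : classFunctions G :=
  ⟨Set.indicator {k | IsConj g k} 1, by
    intro k h
    have e : IsConj g (h * k * h⁻¹) ↔ IsConj g k := by
      have hk : IsConj k (h * k * h⁻¹) := isConj_iff.2 ⟨h, rfl⟩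
      exact ⟨fun H => H.trans hk.symm, fun H => H.trans hk⟩
    classical
    simp only [Set.indicator_apply, Set.mem_ofPred_eq, e, Pi.one_apply]⟩

open scoped Classical in
/-- The class function `Ind_H^G φ` induced from the class function `φ` on the subgroup `H`:
`g ↦ |H|⁻¹ ∑ φ(k⁻¹ g k)`, the sum over the `k` in `G` with `k⁻¹ g k ∈ H`. -/
def induce {G : Type*} [Group G] [Fintype G] (H : Subgroup G) (φ : classFunctions H) :
    classFunctions G :=
  ⟨fun g => (Nat.card H : ℂ)⁻¹ *
      ∑ k : G, if h : k⁻¹ * g * k ∈ H then φ.1 ⟨k⁻¹ * g * k, h⟩ else 0, by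
    intro g h
    beta_reduce
    congr 1
    refine Fintype.sum_equiv (Equiv.mulLeft h⁻¹) _ _ fun k => ?_
    have e : (h⁻¹ * k)⁻¹ * g * (h⁻¹ * k) = k⁻¹ * (h * g * h⁻¹) * k := by group
    simp only [Equiv.coe_mulLeft, e]⟩

instance (n : ℕ) : Fintype (W n) := Fintype.ofFinite _

/-- The character `Ind_{W_p}^{W_n}(1)` of `W_n` induced from the trivial character of `W_p`. -/
def inducedTrivial {n : ℕ} (p : SignedComposition n) : classFunctions (W n) :=
  induce p.youngSubgroup 1

open scoped Classical in
/-- The linear map `θ_n` from `Σ(W_n)` to the class functions on `W_n` with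
`θ_n(x_p) = Ind_{W_p}^{W_n}(1)` for all signed compositions `p` of `n`. It is defined on the basis
`x_p`. (If the spanning family `x_p` were linearly dependent, the value would be the zero map; the
linear independence is never assumed.) -/
def theta (n : ℕ) : mantaciReutenauer n →ₗ[ℂ] classFunctions (W n) :=
  if h : LinearIndependent ℂ (SignedComposition.x (n := n)) then
    (Module.Basis.span h).constr ℂ inducedTrivial
  else 0

/-- The set of descents of `σ`; here `i` with `i + 1 < m` stands for the position `i + 1` in
`{1, …, m - 1}`. -/
def descents {m : ℕ} (σ : Equiv.Perm (Fin m)) : Set ℕ :=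
  {i | ∃ h : i + 1 < m, σ ⟨i + 1, h⟩ < σ ⟨i, Nat.lt_of_succ_lt h⟩}

/-- The sum in `ℂ W_m` of the elements of `S_m` whose descents all lie in `A`. -/
def descentSum (m : ℕ) (A : Finset ℕ) : MonoidAlgebra ℂ (W m) :=
  ∑ σ ∈ (Set.toFinite {σ : Equiv.Perm (Fin m) | descents σ ⊆ A}).toFinset,
    MonoidAlgebra.single (ofPerm σ) 1

/-- The Reutenauer idempotent `r_m`. -/
def reutenauer (m : ℕ) : MonoidAlgebra ℂ (W m) :=
  ∑ A ∈ (Finset.range (m - 1)).powerset,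
    ((-1 : ℂ) ^ A.card / ((A.card : ℂ) + 1)) • descentSum m A

/-- The longest element `a ↦ -a` of `W_m`. -/
def longest (m : ℕ) : W m := ofPermSign 1 (fun _ => -1)

/-- `ε_m^+ = (1/2)(id + w_{0,m})`. -/
def epsPlus (m : ℕ) : MonoidAlgebra ℂ (W m) :=
  (1 / 2 : ℂ) • (MonoidAlgebra.single 1 1 + MonoidAlgebra.single (longest m) 1)

/-- `ε_m^- = (1/2)(id - w_{0,m})`. -/
def epsMinus (m : ℕ) : MonoidAlgebra ℂ (W m) :=
  (1 / 2 : ℂ) • (MonoidAlgebra.single 1 1 - MonoidAlgebra.single (longest m) 1)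

/-- The positive `m`-cycle `(1 2 ⋯ m)`, the element `w_λ` for `λ = (m)`. -/
def posCycle (m : ℕ) : W m := ofPerm (finRotate m)

/-- The element `w_λ` for `λ = (-m)`, of signed cycle type `(-m)`: the product of `(1 2 ⋯ m)` and
the longest element if `m` is odd, and the negative `m`-cycle `(1 2 ⋯ m)⁻` (which sends `j` to
`j + 1` for `j < m`, and `m` to `-1`) if `m` is even. -/
def negCycle (m : ℕ) : W m :=
  if Odd m then posCycle m * longest m
  else ofPermSign (finRotate m) (fun j => if (j : ℕ) + 1 = m then -1 else 1)

/-- `u_{(m)}`, the characteristic function of the class of signed cycle type `(m)`. -/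
def uPos (m : ℕ) : classFunctions (W m) := classIndicator (posCycle m)

/-- `u_{(-m)}`, the characteristic function of the class of signed cycle type `(-m)`. -/
def uNeg (m : ℕ) : classFunctions (W m) := classIndicator (negCycle m)

end Hyperoctahedral

end

/-! Both `reutenauer m` and its product with the longest element w₀ are expanded explicitly in the
elements x_p. Then `theta` is evaluated at each v, where the induced characters become counts of
labelings fixed by v.

The expansion rests on 1/(|A|+1) = ∫₀¹ y^|A| dy. Under the integral, the coefficient of a
permutation in r_m is a product of local factors: -y at a descent and 1-y at an ascent. A signed
composition of m is likewise a word: a first sign, and then for each later position either "same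
block" or the sign of the block starting there. Membership in X_p is tested letter by letter, so a
combination of the x_p with multiplicative weights again has product coefficients (`sum_weight`).
Suitable weights give r_m (`reutenauer_eq_sum_x`) and w₀ r_m (`longest_mul_reutenauer_eq_sum_x`); a
change of sign in the wrong direction makes a local factor vanish.

The value of Ind(1) at v counts the fixed cosets of W_p. Cosets correspond to labelings of positions
by blocks, with signs on the negative blocks. Summing over all p with a given sign vector s
therefore counts all fixed surjective labelings (`sum_inducedTrivial`), a number depending only on
how many entries of s are positive. For r_m only all-positive s survive, and the surjections
constant on the cycles of |v|, weighted by (-1)^k/(k+1), sum to 1 or 0 according as |v| is a single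
cycle or not (`sum_numInvariantSurj`). For w₀ r_m the Beta integrals cancel the binomial
coefficients and the sum over s telescopes to all-negative minus all-positive
(`sum_signs_mul_numFixed`). This gives (-1)^(m-1)(f-1) times the same indicator, where f is the
number of sign functions fixed by v. On a single cycle f is 2 or 0, so f-1 is the product of the
signs of v, which separates the two classes of single cycles.

Linear independence of the x_p, needed for `theta` to be the intended map, comes from a
triangularity argument: each p has an element of X_p lying in no other X_q of rank at least that of
p. -/

namespace Hyperoctahedral

open Finset Polynomial

/-! ### Signed permutations as permutations with signs -/

section Coordinates

variable {n : ℕ}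

/-- The permutation of `Fin n` underlying a signed permutation. -/
def absPerm (w : W n) : Equiv.Perm (Fin n) where
  toFun j := (w.1 (j, 1)).1
  invFun j := (w.1.symm (j, 1)).1
  left_inv j := by
    rcases h : w.1 (j, 1) with ⟨i, ε⟩
    change (w.1.symm ((w.1 (j, 1)).1, 1)).1 = j
    rw [h]
    rcases Int.units_eq_one_or ε with rfl | rfl
    · rw [← h, Equiv.symm_apply_apply]
    · have hb : w.1 (j, -1) = (i, 1) := by
        have := w.2 (j, 1)
        simpa [bar, h] using this
      rw [← hb, Equiv.symm_apply_apply]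
  right_inv j := by
    rcases h : w.1.symm (j, 1) with ⟨i, ε⟩
    have h' : w.1 (i, ε) = (j, 1) := by simp [← h]
    change (w.1 ((w.1.symm (j, 1)).1, 1)).1 = j
    rw [h]
    rcases Int.units_eq_one_or ε with rfl | rfl
    · rw [h']
    · have hb : w.1 (i, 1) = (j, -1) := by
        have := w.2 (i, -1)
        simpa [bar, h'] using this
      rw [hb]

/-- The signs of a signed permutation. -/
def sgn (w : W n) (j : Fin n) : ℤˣ := (w.1 (j, 1)).2

theorem coe_apply (w : W n) (j : Fin n) (ε : ℤˣ) :
    w.1 (j, ε) = (absPerm w j, sgn w j * ε) := by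
  rcases Int.units_eq_one_or ε with rfl | rfl
  · simp [absPerm, sgn]
  · have := w.2 (j, 1)
    simp only [bar] at this
    simp [absPerm, sgn, this]

theorem ext_coord {u v : W n} (h1 : absPerm u = absPerm v) (h2 : sgn u = sgn v) : u = v := by
  refine Subtype.ext (Equiv.ext fun ⟨j, ε⟩ => ?_)
  rw [coe_apply, coe_apply, h1, h2]

@[simp] theorem absPerm_one : absPerm (1 : W n) = 1 := rfl

@[simp] theorem sgn_one (j : Fin n) : sgn (1 : W n) j = 1 := rfl

@[simp] theorem absPerm_mul (u v : W n) : absPerm (u * v) = absPerm u * absPerm v := by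
  ext j
  have : (u * v).1 (j, 1) = u.1 (v.1 (j, 1)) := rfl
  rw [coe_apply, coe_apply, coe_apply] at this
  have h := congrArg (fun a : SignedPoint n => (a.1 : ℕ)) this
  simpa using h

@[simp] theorem sgn_mul (u v : W n) (j : Fin n) :
    sgn (u * v) j = sgn u (absPerm v j) * sgn v j := by
  have : (u * v).1 (j, 1) = u.1 (v.1 (j, 1)) := rfl
  rw [coe_apply, coe_apply, coe_apply] at this
  simpa using congrArg Prod.snd this

@[simp] theorem absPerm_inv (u : W n) : absPerm u⁻¹ = (absPerm u)⁻¹ := by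
  rw [eq_inv_iff_mul_eq_one, ← absPerm_mul]
  simp

@[simp] theorem absPerm_ofPermSign (σ : Equiv.Perm (Fin n)) (s : Fin n → ℤˣ) :
    absPerm (ofPermSign σ s) = σ := by
  ext j
  rfl

@[simp] theorem sgn_ofPermSign (σ : Equiv.Perm (Fin n)) (s : Fin n → ℤˣ) :
    sgn (ofPermSign σ s) = s := by
  ext j
  simp [sgn, ofPermSign]

/-- The signed value of `w` at `j`, as an integer in `{±1, …, ±n}`. -/
def val (w : W n) (j : Fin n) : ℤ := (sgn w j : ℤ) * ((absPerm w j : ℕ) + 1)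

theorem val_of_sgn_eq_one {w : W n} {j : Fin n} (h : sgn w j = 1) :
    val w j = (absPerm w j : ℕ) + 1 := by simp [val, h]

theorem val_of_sgn_eq_neg_one {w : W n} {j : Fin n} (h : sgn w j = -1) :
    val w j = -((absPerm w j : ℕ) + 1) := by simp [val, h]

theorem val_pos_iff (w : W n) (j : Fin n) : 0 < val w j ↔ sgn w j = 1 := by
  rcases Int.units_eq_one_or (sgn w j) with h | h
  · simp only [h, iff_true, val_of_sgn_eq_one h]
    omega
  · rw [val_of_sgn_eq_neg_one h, h]
    refine ⟨fun h' => by omega, fun h' => absurd h' (by decide)⟩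

theorem val_neg_iff (w : W n) (j : Fin n) : val w j < 0 ↔ sgn w j = -1 := by
  rcases Int.units_eq_one_or (sgn w j) with h | h
  · rw [val_of_sgn_eq_one h, h]
    refine ⟨fun h' => by omega, fun h' => absurd h' (by decide)⟩
  · simp only [h, iff_true, val_of_sgn_eq_neg_one h]
    omega

theorem val_ne_zero (w : W n) (j : Fin n) : val w j ≠ 0 := by
  rcases Int.units_eq_one_or (sgn w j) with h | h
  · exact ((val_pos_iff w j).2 h).ne'
  · exact ((val_neg_iff w j).2 h).ne

theorem val_mul (u v : W n) (j : Fin n) :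
    val (u * v) j = (sgn v j : ℤ) * val u (absPerm v j) := by
  simp only [val, sgn_mul, absPerm_mul, Units.val_mul, Equiv.Perm.mul_apply]
  ring

theorem val_injective (w : W n) : Function.Injective (val w) := by
  intro i j h
  have h' : (val w i).natAbs = (val w j).natAbs := by rw [h]
  simp only [val, Int.natAbs_mul, Int.units_natAbs, one_mul] at h'
  exact (absPerm w).injective (Fin.ext (by omega))

end Coordinates

/-! ### Coxeter length as the number of type B inversions -/

section Length

variable {n : ℕ}

/-- The contribution of a pair of positions to the number of inversions of type `B`. -/
def pairInv (f : Fin n → ℤ) (p : Fin n × Fin n) : ℕ :=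
  if p.1 < p.2 then (if f p.2 < f p.1 then 1 else 0) + (if f p.1 + f p.2 < 0 then 1 else 0)
  else if p.1 = p.2 then (if f p.1 < 0 then 1 else 0) else 0

/-- The number of inversions of type `B` of the window `f`. -/
def invs (f : Fin n → ℤ) : ℕ := ∑ p, pairInv f p

/-- Valid at every position, not only the first: this makes any sign change of a negative entry
shorten the element, although most sign changes are not Coxeter generators. -/
theorem pairInv_update_neg_le {f : Fin n → ℤ} {j : Fin n} (hj : f j < 0) (p : Fin n × Fin n) :
    pairInv (Function.update f j (-f j)) p ≤ pairInv f p := by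
  rcases p with ⟨a, b⟩
  by_cases ha : a = j <;> by_cases hb : b = j
  · subst ha; subst hb
    simp only [pairInv, lt_irrefl, if_false, if_true, Function.update_self]
    split_ifs <;> omega
  · subst ha
    simp only [pairInv, Function.update_self, Function.update_of_ne hb]
    split_ifs <;> omega
  · subst hb
    simp only [pairInv, Function.update_self, Function.update_of_ne ha, ha, if_false]
    split_ifs <;> omega
  · simp only [pairInv, Function.update_of_ne ha, Function.update_of_ne hb]
    exact le_rfl

theorem invs_update_neg_lt {f : Fin n → ℤ} {j : Fin n} (hj : f j < 0) :
    invs (Function.update f j (-f j)) < invs f := by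
  refine Finset.sum_lt_sum (fun p _ => pairInv_update_neg_le hj p) ⟨(j, j), mem_univ _, ?_⟩
  simp only [pairInv, lt_irrefl, if_false, if_true, Function.update_self]
  split_ifs <;> omega

/-- For a pair (j, b) with j < b, negating f j merely exchanges the conditions f b < f j and f j + f
b < 0. No pair ends at the first position, so only the diagonal term changes. -/
theorem pairInv_update_neg_first {f : Fin n → ℤ} {j : Fin n} (hj : ∀ i, j ≤ i)
    {p : Fin n × Fin n} (hp : p ≠ (j, j)) :
    pairInv (Function.update f j (-f j)) p = pairInv f p := by
  rcases p with ⟨a, b⟩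
  by_cases ha : a = j <;> by_cases hb : b = j
  · subst ha; subst hb
    exact absurd rfl hp
  · subst ha
    simp only [pairInv, Function.update_self, Function.update_of_ne hb, Ne.symm hb, if_false]
    split_ifs <;> omega
  · subst hb
    simp [pairInv, ha, (hj a).not_gt]
  · simp only [pairInv, Function.update_of_ne ha, Function.update_of_ne hb]

theorem invs_update_neg_first_le {f : Fin n → ℤ} {j : Fin n} (hj : ∀ i, j ≤ i) :
    invs (Function.update f j (-f j)) ≤ invs f + 1 := by
  rw [invs, invs, ← Finset.add_sum_erase _ _ (mem_univ (j, j)),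
    ← Finset.add_sum_erase (a := (j, j)) univ (pairInv f) (mem_univ _),
    Finset.sum_congr rfl fun p hp => pairInv_update_neg_first hj (Finset.ne_of_mem_erase hp)]
  have : pairInv (Function.update f j (-f j)) (j, j) ≤ 1 := by
    simp only [pairInv, lt_irrefl, if_false, if_true]
    split_ifs <;> omega
  omega

theorem swap_adjacent_lt {i j a b : Fin n} (hij : (i : ℕ) + 1 = j) (hab : a < b)
    (h : (a, b) ≠ (i, j)) : Equiv.swap i j a < Equiv.swap i j b := by
  simp only [ne_eq, Prod.mk.injEq, not_and, Fin.ext_iff] at h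
  rw [Fin.lt_def] at *
  simp only [Equiv.swap_apply_def, Fin.ext_iff]
  split_ifs <;> omega

theorem pairInv_swap {f : Fin n → ℤ} {i j : Fin n} (hij : (i : ℕ) + 1 = j) {p : Fin n × Fin n}
    (hp : p ≠ (i, j)) (hp' : p ≠ (j, i)) :
    pairInv (f ∘ Equiv.swap i j) p = pairInv f (Equiv.swap i j p.1, Equiv.swap i j p.2) := by
  rcases p with ⟨a, b⟩
  have key : Equiv.swap i j a < Equiv.swap i j b ↔ a < b := by
    refine ⟨fun h => ?_, fun h => swap_adjacent_lt hij h hp⟩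
    have := swap_adjacent_lt hij h (fun e => hp' ?_)
    · simpa using this
    · simp only [Prod.mk.injEq] at e ⊢
      rw [Equiv.swap_apply_eq_iff, Equiv.swap_apply_eq_iff] at e
      simpa using e
  simp only [pairInv, key, Function.comp_apply, EmbeddingLike.apply_eq_iff_eq]

/-- An adjacent transposition permutes all other ordered pairs without changing their contributions,
so only the pair (i, j) matters. The equation is additive to avoid subtraction in ℕ. -/
theorem invs_swap {f : Fin n → ℤ} {i j : Fin n} (hij : (i : ℕ) + 1 = j) :
    invs (f ∘ Equiv.swap i j) + pairInv f (i, j) =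
      invs f + pairInv (f ∘ Equiv.swap i j) (i, j) := by
  have hne : ((i, j) : Fin n × Fin n) ≠ (j, i) := by
    intro h
    simp only [Prod.mk.injEq, Fin.ext_iff] at h
    omega
  have h0 : ∀ g : Fin n → ℤ, pairInv g (j, i) = 0 := by
    intro g
    have h1 : ¬ j < i := by rw [Fin.lt_def]; omega
    have h2 : ¬ j = i := by rw [Fin.ext_iff]; omega
    simp [pairInv, h1, h2]
  have hs : ∀ g : Fin n → ℤ, invs g =
      pairInv g (i, j) + ∑ p ∈ ((univ.erase (i, j)).erase (j, i)), pairInv g p := by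
    intro g
    rw [invs, ← Finset.add_sum_erase _ _ (mem_univ (i, j)),
      ← Finset.add_sum_erase (univ.erase (i, j)) (pairInv g) (a := (j, i)) (by simp [hne.symm]),
      h0, zero_add]
  rw [hs f, hs (f ∘ Equiv.swap i j)]
  have : ∑ p ∈ ((univ.erase (i, j)).erase (j, i)), pairInv (f ∘ Equiv.swap i j) p =
      ∑ p ∈ ((univ.erase (i, j)).erase (j, i)), pairInv f p := by
    refine Finset.sum_nbij' (fun p => (Equiv.swap i j p.1, Equiv.swap i j p.2))
      (fun p => (Equiv.swap i j p.1, Equiv.swap i j p.2)) ?_ ?_ ?_ ?_ ?_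
    · rintro ⟨a, b⟩ h
      simp only [mem_erase, ne_eq, Prod.mk.injEq, mem_univ, and_true,
        Equiv.swap_apply_eq_iff, Equiv.swap_apply_left, Equiv.swap_apply_right] at h ⊢
      exact ⟨h.2, h.1⟩
    · rintro ⟨a, b⟩ h
      simp only [mem_erase, ne_eq, Prod.mk.injEq, mem_univ, and_true,
        Equiv.swap_apply_eq_iff, Equiv.swap_apply_left, Equiv.swap_apply_right] at h ⊢
      exact ⟨h.2, h.1⟩
    · intro p _; simp
    · intro p _; simp
    · intro p h
      simp only [mem_erase] at h
      exact pairInv_swap hij h.2.1 h.1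
  omega

theorem invs_swap_le {f : Fin n → ℤ} {i j : Fin n} (hij : (i : ℕ) + 1 = j) :
    invs (f ∘ Equiv.swap i j) ≤ invs f + 1 := by
  have h := invs_swap (f := f) hij
  have hlt : i < j := by rw [Fin.lt_def]; omega
  simp only [pairInv, hlt, if_true, Function.comp_apply, Equiv.swap_apply_left,
    Equiv.swap_apply_right] at h
  split_ifs at h <;> omega

theorem invs_swap_lt {f : Fin n → ℤ} {i j : Fin n} (hij : (i : ℕ) + 1 = j) (hf : f j < f i) :
    invs (f ∘ Equiv.swap i j) < invs f := by
  have h := invs_swap (f := f) hij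
  have hlt : i < j := by rw [Fin.lt_def]; omega
  simp only [pairInv, hlt, if_true, Function.comp_apply, Equiv.swap_apply_left,
    Equiv.swap_apply_right] at h
  split_ifs at h <;> omega

/-- The sign change at the position `j`. -/
def signChange (j : Fin n) : W n := ofPermSign 1 (Function.update 1 j (-1))

theorem val_mul_signChange (w : W n) (j : Fin n) :
    val (w * signChange j) = Function.update (val w) j (-val w j) := by
  ext a
  rw [val_mul, signChange, sgn_ofPermSign, absPerm_ofPermSign]
  by_cases h : a = j
  · subst h; simp
  · simp [h]

theorem val_mul_ofPerm (w : W n) (σ : Equiv.Perm (Fin n)) :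
    val (w * ofPerm σ) = val w ∘ σ := by
  ext a
  simp [val_mul, ofPerm]

theorem invs_mul_simple_le (w : W n) {g : W n} (hg : g ∈ simpleReflections n) :
    invs (val (w * g)) ≤ invs (val w) + 1 := by
  rcases hg with ⟨h, rfl⟩ | ⟨i, h, rfl⟩
  · have := val_mul_signChange w ⟨0, h⟩
    rw [signChange] at this
    rw [this]
    exact invs_update_neg_first_le fun i => Fin.mk_le_of_le_val (Nat.zero_le _)
  · rw [val_mul_ofPerm]
    exact invs_swap_le rfl

theorem strictMono_perm_eq_one {σ : Equiv.Perm (Fin n)} (h : StrictMono σ) : σ = 1 := by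
  have h2 : (h.orderIsoOfSurjective σ σ.surjective) = OrderIso.refl _ := Subsingleton.elim _ _
  ext j
  have := congrArg (fun e : Fin n ≃o Fin n => ((e j : Fin n) : ℕ)) h2
  simpa using this

theorem strictMono_of_adjacent {α : Type*} [Preorder α] {f : Fin n → α}
    (h : ∀ i j : Fin n, (i : ℕ) + 1 = j → f i < f j) : StrictMono f := by
  cases n with
  | zero => intro i; exact i.elim0
  | succ n => exact Fin.strictMono_iff_lt_succ.2 fun i => h _ _ (by simp)

/-- If no generator lowers the inversion number, the window is increasing with a positive first
entry, hence is the identity. -/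
theorem exists_descent {w : W n} (hw : w ≠ 1) :
    ∃ g ∈ simpleReflections n, invs (val (w * g)) < invs (val w) := by
  by_contra! hcon
  apply hw
  have hmono : StrictMono (val w) := by
    refine strictMono_of_adjacent fun i j hij => ?_
    by_contra! hlt
    have hne : i ≠ j := by rw [Ne, Fin.ext_iff]; omega
    have hlt' := lt_of_le_of_ne hlt fun e => hne (val_injective w e.symm)
    have hg : ofPerm (Equiv.swap i j) ∈ simpleReflections n := by
      refine Or.inr ⟨i, by omega, ?_⟩
      congr 2
      exact Fin.ext hij.symm
    have := hcon _ hg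
    rw [val_mul_ofPerm] at this
    exact absurd (invs_swap_lt hij hlt') (not_lt.2 this)
  have hpos : ∀ j, sgn w j = 1 := by
    intro j
    rw [← val_pos_iff]
    have hn : 0 < n := j.pos
    have h0 : 0 < val w ⟨0, hn⟩ := by
      by_contra! hle
      have hlt := lt_of_le_of_ne hle (val_ne_zero w _)
      have hg : signChange ⟨0, hn⟩ ∈ simpleReflections n := Or.inl ⟨hn, rfl⟩
      have := hcon _ hg
      rw [val_mul_signChange] at this
      exact absurd (invs_update_neg_lt hlt) (not_lt.2 this)
    exact h0.trans_le (hmono.monotone (Fin.mk_le_of_le_val (Nat.zero_le _)))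
  refine ext_coord (strictMono_perm_eq_one fun i j hij => ?_) (funext hpos)
  have := hmono hij
  rw [val_of_sgn_eq_one (hpos i), val_of_sgn_eq_one (hpos j)] at this
  rw [Fin.lt_def]
  omega

theorem invs_prod_le (l : List (W n)) (hl : ∀ g ∈ l, g ∈ simpleReflections n) :
    invs (val l.prod) ≤ l.length := by
  induction l using List.reverseRecOn with
  | nil =>
    simp only [List.prod_nil, List.length_nil, nonpos_iff_eq_zero, invs]
    refine Finset.sum_eq_zero fun p _ => ?_
    have h : ∀ a : Fin n, val 1 a = (a : ℕ) + 1 := fun a => val_of_sgn_eq_one rfl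
    simp only [pairInv, h]
    split_ifs <;> simp_all <;> omega
  | append_singleton l g ih =>
    rw [List.prod_append, List.prod_singleton, List.length_append]
    refine (invs_mul_simple_le _ (hl g (by simp))).trans ?_
    simpa using ih fun g hg => hl g (by simp [hg])

theorem mul_self_of_mem_simpleReflections {g : W n} (hg : g ∈ simpleReflections n) : g * g = 1 := by
  rcases hg with ⟨h, rfl⟩ | ⟨i, h, rfl⟩
  · refine ext_coord (by simp) (funext fun j => ?_)
    simp only [sgn_mul, sgn_ofPermSign, absPerm_ofPermSign]
    simp
  · refine ext_coord (by simp [ofPerm]) (funext fun j => ?_)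
    simp [ofPerm]

theorem exists_word (w : W n) : ∃ l : List (W n), (∀ g ∈ l, g ∈ simpleReflections n) ∧
    l.prod = w ∧ l.length ≤ invs (val w) := by
  induction h : invs (val w) using Nat.strong_induction_on generalizing w with
  | _ k ih =>
    by_cases hw : w = 1
    · exact ⟨[], by simp, by simp [hw], by simp⟩
    · obtain ⟨g, hg, hlt⟩ := exists_descent hw
      obtain ⟨l, hl, hprod, hlen⟩ := ih _ (h ▸ hlt) (w * g) rfl
      refine ⟨l ++ [g], ?_, ?_, ?_⟩
      · intro x hx
        rcases List.mem_append.1 hx with hx | hx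
        · exact hl x hx
        · rwa [List.mem_singleton.1 hx]
      · rw [List.prod_append, hprod, List.prod_singleton, mul_assoc,
          mul_self_of_mem_simpleReflections hg, mul_one]
      · simp only [List.length_append, List.length_singleton]
        omega

/-- The Coxeter length of a signed permutation is its number of inversions of type `B`. -/
theorem length_eq_invs (w : W n) : length w = invs (val w) := by
  obtain ⟨l, hl, hprod, hlen⟩ := exists_word w
  apply le_antisymm
  · refine le_trans (Nat.sInf_le ?_) hlen
    exact ⟨l, hl, hprod, rfl⟩
  · refine le_csInf ⟨_, l, hl, hprod, rfl⟩ ?_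
    rintro k ⟨l', hl', rfl, rfl⟩
    exact invs_prod_le l' hl'

theorem length_mul_signChange_lt {w : W n} {j : Fin n} (h : val w j < 0) :
    length (w * signChange j) < length w := by
  rw [length_eq_invs, length_eq_invs, val_mul_signChange]
  exact invs_update_neg_lt h

theorem length_mul_swap_lt {w : W n} {i j : Fin n} (hij : (i : ℕ) + 1 = j)
    (h : val w j < val w i) : length (w * ofPerm (Equiv.swap i j)) < length w := by
  rw [length_eq_invs, length_eq_invs, val_mul_ofPerm]
  exact invs_swap_lt hij h

end Length

/-! ### Blocks of a signed composition -/

namespace SignedComposition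

variable {n : ℕ} (p q : SignedComposition n)

theorem partialSum_succ {i : ℕ} (h : i < p.parts.length) :
    p.partialSum (i + 1) = p.partialSum i + p.parts[i].natAbs := by
  simp only [partialSum]
  rw [List.map_take, List.map_take, List.sum_take_succ _ _ (by simpa using h)]
  simp

theorem partialSum_of_length_le {i : ℕ} (h : p.parts.length ≤ i) : p.partialSum i = n := by
  rw [partialSum, List.take_of_length_le h, p.sum_natAbs]

theorem partialSum_mono : Monotone p.partialSum := by
  refine monotone_nat_of_le_succ fun i => ?_
  rcases lt_or_ge i p.parts.length with h | h
  · rw [p.partialSum_succ h]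
    exact Nat.le_add_right _ _
  · rw [p.partialSum_of_length_le h, p.partialSum_of_length_le (h.trans (Nat.le_succ i))]

theorem partialSum_lt_succ {i : ℕ} (h : i < p.parts.length) :
    p.partialSum i < p.partialSum (i + 1) := by
  rw [p.partialSum_succ h]
  have := Int.natAbs_pos.2 (p.ne_zero _ (List.getElem_mem h))
  omega

theorem partialSum_le (i : ℕ) : p.partialSum i ≤ n := by
  have := p.partialSum_mono (le_max_left i p.parts.length)
  rwa [p.partialSum_of_length_le (le_max_right i p.parts.length)] at this

theorem exists_lt_partialSum (j : Fin n) : ∃ i, (j : ℕ) < p.partialSum (i + 1) :=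
  ⟨p.parts.length, by rw [p.partialSum_of_length_le (Nat.le_succ _)]; exact j.2⟩

/-- The index of the block that contains `j`. -/
def idx (j : Fin n) : ℕ := Nat.find (p.exists_lt_partialSum j)

theorem lt_partialSum_idx (j : Fin n) : (j : ℕ) < p.partialSum (p.idx j + 1) :=
  Nat.find_spec (p.exists_lt_partialSum j)

theorem partialSum_idx_le (j : Fin n) : p.partialSum (p.idx j) ≤ j := by
  rcases h : p.idx j with _ | i
  · exact Nat.zero_le _
  · exact not_lt.1 (Nat.find_min (p.exists_lt_partialSum j) (show i < p.idx j by omega))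

theorem idx_lt_iff {j : Fin n} {i : ℕ} : p.idx j < i ↔ (j : ℕ) < p.partialSum i := by
  refine ⟨fun h => (p.lt_partialSum_idx j).trans_le (p.partialSum_mono h), fun h => ?_⟩
  by_contra! hle
  exact absurd ((p.partialSum_mono hle).trans (p.partialSum_idx_le j)) (not_le.2 h)

theorem idx_lt_length (j : Fin n) : p.idx j < p.parts.length := by
  rw [idx_lt_iff, p.partialSum_of_length_le le_rfl]
  exact j.2

theorem idx_mono : Monotone p.idx := by
  intro i j hij
  by_contra! h
  rw [idx_lt_iff] at h
  have := p.partialSum_idx_le i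
  have : (i : ℕ) ≤ j := hij
  omega

theorem mem_block_iff {i : Fin p.parts.length} {j : Fin n} : j ∈ p.block i ↔ p.idx j = i := by
  have h1 := p.idx_lt_iff (j := j) (i := i)
  have h2 := p.idx_lt_iff (j := j) (i := i + 1)
  simp only [block, Set.mem_ofPred_eq]
  omega

theorem exists_idx_eq {i : ℕ} (h : i < p.parts.length) : ∃ j, p.idx j = i := by
  have h1 := p.partialSum_lt_succ h
  have h2 := p.partialSum_le (i + 1)
  refine ⟨⟨p.partialSum i, by omega⟩, ?_⟩
  exact (p.mem_block_iff (i := ⟨i, h⟩)).1 ⟨le_rfl, h1⟩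

/-- Whether the part with the index `i` is positive. -/
def isPos (i : ℕ) : Bool := decide (0 < p.parts.getD i 0)

theorem isPos_eq_false_iff {i : ℕ} (h : i < p.parts.length) :
    p.isPos i = false ↔ p.parts[i] < 0 := by
  have := p.ne_zero _ (List.getElem_mem h)
  simp only [isPos, List.getD_eq_getElem _ _ h, decide_eq_false_iff_not, not_lt]
  omega

variable {p q} in
theorem ext_idx (hl : p.parts.length = q.parts.length) (hi : ∀ j, p.idx j = q.idx j)
    (hs : ∀ i < p.parts.length, p.isPos i = q.isPos i) : p = q := by
  have hps : ∀ i, p.partialSum i = q.partialSum i := by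
    intro i
    by_contra hne
    have hp := p.partialSum_le i
    have hq := q.partialSum_le i
    rcases Nat.lt_or_gt_of_ne hne with h | h
    · have h1 := p.idx_lt_iff (j := ⟨p.partialSum i, by omega⟩) (i := i)
      have h2 := q.idx_lt_iff (j := ⟨p.partialSum i, by omega⟩) (i := i)
      rw [hi] at h1
      exact lt_irrefl _ ((h1.symm.trans h2).2 h)
    · have h1 := p.idx_lt_iff (j := ⟨q.partialSum i, by omega⟩) (i := i)
      have h2 := q.idx_lt_iff (j := ⟨q.partialSum i, by omega⟩) (i := i)
      rw [hi] at h1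
      exact lt_irrefl _ ((h1.symm.trans h2).1 h)
  have hparts : p.parts = q.parts := by
    refine List.ext_getElem hl fun i h1 h2 => ?_
    have e1 := p.partialSum_succ h1
    have e2 := q.partialSum_succ h2
    rw [hps, hps, e2] at e1
    have hs' := hs i h1
    have n1 := p.isPos_eq_false_iff h1
    have n2 := q.isPos_eq_false_iff h2
    rw [hs', n2] at n1
    omega
  cases p; cases q
  simp only [mk.injEq]
  exact hparts

theorem exists_of_monotone {k : ℕ} (c : Fin n → Fin k) (hc : Monotone c)
    (hsurj : Function.Surjective c) (s : Fin k → Bool) :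
    ∃ p : SignedComposition n, p.parts.length = k ∧ (∀ j, p.idx j = c j) ∧
      ∀ i : Fin k, p.isPos i = s i := by
  have hcard : ∀ i, 0 < #{j | c j = i} := by
    intro i
    obtain ⟨j, hj⟩ := hsurj i
    exact Finset.card_pos.2 ⟨j, by simp [hj]⟩
  -- The parts are the fibre sizes of c, with the prescribed signs.
  set f : Fin k → ℤ := fun i => (if s i then 1 else -1) * (#{j | c j = i} : ℤ) with hf
  have hfabs : ∀ i, (f i).natAbs = #{j | c j = i} := by
    intro i
    simp only [hf]
    split_ifs <;> simp
  have hsum : ∀ i : ℕ, (((List.ofFn f).take i).map Int.natAbs).sum = #{j | (c j : ℕ) < i} := by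
    intro i
    rw [List.map_take, List.map_ofFn, List.sum_take_ofFn]
    simp only [Function.comp_apply, hfabs]
    rw [Finset.card_eq_sum_card_fiberwise (f := c) (t := univ.filter fun a : Fin k => (a : ℕ) < i)]
    · refine Finset.sum_congr rfl fun a ha => ?_
      congr 1
      ext j
      simp only [mem_filter, mem_univ, true_and] at ha ⊢
      exact ⟨fun h => ⟨h ▸ ha, h⟩, fun h => h.2⟩
    · intro j hj
      simpa using hj
  have hlen : (List.ofFn f).length = k := List.length_ofFn
  refine ⟨⟨List.ofFn f, ?_, ?_⟩, hlen, ?_, ?_⟩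
  · intro a ha
    obtain ⟨i, rfl⟩ := (List.mem_ofFn' _ _).1 ha
    rw [Ne, ← Int.natAbs_eq_zero, hfabs]
    exact (hcard i).ne'
  · have := hsum k
    rw [List.take_of_length_le hlen.le] at this
    rw [this]
    simp
  · intro j
    -- By monotonicity {c < i} is an initial segment, so its size exceeds j exactly when it contains
    -- j.
    refine eq_of_forall_gt_iff fun i => ?_
    rw [idx_lt_iff, partialSum, hsum i]
    constructor
    · intro h
      by_contra! hle
      have hsub : (univ.filter fun a => (c a : ℕ) < i) ⊆ Finset.Iio j := by
        intro a ha
        rw [mem_Iio]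
        by_contra! hja
        have h1 : c j ≤ c a := hc hja
        have h2 : (c j : ℕ) ≤ c a := h1
        simp only [mem_filter, mem_univ, true_and] at ha
        omega
      have := Finset.card_le_card hsub
      rw [Fin.card_Iio] at this
      omega
    · intro h
      have hsub : Finset.Iic j ⊆ univ.filter fun a => (c a : ℕ) < i := by
        intro a ha
        have h1 : c a ≤ c j := hc (mem_Iic.1 ha)
        have h2 : (c a : ℕ) ≤ c j := h1
        simp only [mem_filter, mem_univ, true_and]
        omega
      have := Finset.card_le_card hsub
      rw [Fin.card_Iic] at this
      omega
  · intro i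
    have hi : (i : ℕ) < (List.ofFn f).length := hlen.symm ▸ i.2
    simp only [isPos, List.getD_eq_getElem _ _ hi, List.getElem_ofFn]
    have := hcard i
    simp only [hf]
    split_ifs with h
    · simp [h, this]
    · simp [h]

/-! ### Minimal coset representatives -/

theorem mem_youngSubgroup_iff {w : W n} : w ∈ p.youngSubgroup ↔
    ∀ j, p.idx (absPerm w j) = p.idx j ∧ (p.isPos (p.idx j) = false → sgn w j = 1) := by
  change (∀ i : Fin p.parts.length, ∀ j ∈ p.block i,
        (w.1 (j, 1)).1 ∈ p.block i ∧ (p.parts[i] < 0 → (w.1 (j, 1)).2 = 1)) ↔ _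
  constructor
  · intro h j
    have := h ⟨p.idx j, p.idx_lt_length j⟩ j (p.mem_block_iff.2 rfl)
    rw [coe_apply, mem_block_iff, mul_one] at this
    exact ⟨this.1, fun h => this.2 ((p.isPos_eq_false_iff (p.idx_lt_length j)).1 h)⟩
  · intro h i j hj
    rw [mem_block_iff] at hj
    rw [coe_apply, mem_block_iff, mul_one]
    obtain ⟨h1, h2⟩ := h j
    rw [hj] at h1 h2
    exact ⟨h1, fun hn => h2 ((p.isPos_eq_false_iff i.2).2 hn)⟩

/-- The signed permutations that increase on every block and are positive on the positive
blocks. -/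
def IsAdapted (w : W n) : Prop :=
  (∀ i j, p.idx i = p.idx j → i < j → val w i < val w j) ∧
    ∀ j, p.isPos (p.idx j) = true → 0 < val w j

-- Uniqueness of the adapted element in a coset of W_p: positivity on positive blocks forces v to
-- have no signs, and monotonicity on blocks then forces it to be increasing.
variable {p} in
theorem IsAdapted.eq_one_of_mul {w v : W n} (hw : p.IsAdapted w) (hwv : p.IsAdapted (w * v))
    (hv : v ∈ p.youngSubgroup) : v = 1 := by
  rw [mem_youngSubgroup_iff] at hv
  have hs : ∀ j, sgn v j = 1 := by
    intro j
    rcases h : p.isPos (p.idx j) with _ | _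
    · exact (hv j).2 h
    · have h1 := hwv.2 j h
      have h2 := hw.2 (absPerm v j) ((hv j).1 ▸ h)
      rw [val_mul] at h1
      rcases Int.units_eq_one_or (sgn v j) with h | h
      · exact h
      · rw [h] at h1
        simp at h1
        omega
  have hval : ∀ j, val (w * v) j = val w (absPerm v j) := fun j => by simp [val_mul, hs]
  refine ext_coord (strictMono_perm_eq_one fun i j hij => ?_) (funext hs)
  rcases (p.idx_mono hij.le).eq_or_lt with h | h
  · have h1 := hwv.1 i j h hij
    rw [hval, hval] at h1
    by_contra! hle
    rcases hle.eq_or_lt with e | e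
    · exact hij.ne ((absPerm v).injective e.symm)
    · exact absurd (hw.1 _ _ (by rw [(hv i).1, (hv j).1, h]) e) h1.not_gt
  · by_contra! hle
    have := p.idx_mono hle
    rw [(hv i).1, (hv j).1] at this
    omega

theorem swap_mem_youngSubgroup {i j : Fin n} (h : p.idx i = p.idx j) :
    ofPerm (Equiv.swap i j) ∈ p.youngSubgroup := by
  rw [mem_youngSubgroup_iff]
  intro a
  refine ⟨?_, fun _ => by simp [ofPerm]⟩
  simp only [ofPerm, absPerm_ofPermSign, Equiv.swap_apply_def]
  split_ifs with h1 h2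
  · rw [h1, h]
  · rw [h2, h]
  · rfl

theorem signChange_mem_youngSubgroup {j : Fin n} (h : p.isPos (p.idx j) = true) :
    signChange j ∈ p.youngSubgroup := by
  rw [mem_youngSubgroup_iff]
  intro a
  refine ⟨by simp [signChange], fun ha => ?_⟩
  have hne : a ≠ j := by
    rintro rfl
    rw [h] at ha
    exact absurd ha (by decide)
  simp [signChange, hne]

theorem isAdapted_of_adjacent {w : W n}
    (h1 : ∀ i j : Fin n, (i : ℕ) + 1 = j → p.idx i = p.idx j → val w i < val w j)
    (h2 : ∀ j, p.isPos (p.idx j) = true → 0 < val w j) : p.IsAdapted w := by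
  refine ⟨fun i j hij hlt => ?_, h2⟩
  obtain ⟨d, hd⟩ : ∃ d, (j : ℕ) = i + 1 + d := ⟨j - (i + 1), by have : (i : ℕ) < j := hlt; omega⟩
  induction d generalizing j with
  | zero => exact h1 i j (by omega) hij
  | succ d ih =>
    have hj := j.2
    let j' : Fin n := ⟨i + 1 + d, by omega⟩
    have hlt' : i < j' := by rw [Fin.lt_def]; simp only [j']; omega
    have hle : j' ≤ j := by rw [Fin.le_def]; simp only [j']; omega
    have e1 := p.idx_mono hlt'.le
    have e2 := p.idx_mono hle
    exact (ih j' (by omega) hlt' rfl).trans (h1 j' j (by simp only [j']; omega) (by omega))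

theorem isAdapted_of_mem_minimalCosetReps {w : W n} (hw : w ∈ p.minimalCosetReps) :
    p.IsAdapted w := by
  refine p.isAdapted_of_adjacent (fun i j hij he => ?_) (fun j hj => ?_)
  · by_contra! hle
    have hne : i ≠ j := by rw [Ne, Fin.ext_iff]; omega
    have hlt := lt_of_le_of_ne hle fun e => hne (val_injective w e.symm)
    exact absurd (hw _ (p.swap_mem_youngSubgroup he)) (length_mul_swap_lt hij hlt).not_ge
  · by_contra! hle
    have hlt := lt_of_le_of_ne hle (val_ne_zero w _)
    exact absurd (hw _ (p.signChange_mem_youngSubgroup hj)) (length_mul_signChange_lt hlt).not_ge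

/-- A violated condition could be repaired inside the coset by a shortening swap or sign change, so
minimal elements are adapted. Conversely, the coset of an adapted w has some minimal element; it is
adapted, hence equal to w by uniqueness. -/
theorem mem_minimalCosetReps_iff {w : W n} : w ∈ p.minimalCosetReps ↔ p.IsAdapted w := by
  refine ⟨p.isAdapted_of_mem_minimalCosetReps, fun hw v hv => ?_⟩
  obtain ⟨⟨v₀, hv₀⟩, hmin⟩ := Finite.exists_min fun v : p.youngSubgroup => length (w * v.1)
  have hmem : w * v₀ ∈ p.minimalCosetReps := by
    intro u hu
    rw [mul_assoc]
    exact hmin ⟨v₀ * u, mul_mem hv₀ hu⟩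
  have h1 := hw.eq_one_of_mul (p.isAdapted_of_mem_minimalCosetReps hmem) hv₀
  have := hmin ⟨v, hv⟩
  simpa [h1] using this

open scoped Classical in
theorem x_eq_sum : p.x = ∑ w, (if p.IsAdapted w then (1 : ℂ) else 0) • MonoidAlgebra.single w 1 := by
  simp only [x, ite_smul, one_smul, zero_smul]
  rw [← Finset.sum_filter]
  refine Finset.sum_congr ?_ fun _ _ => rfl
  ext w
  simp [mem_minimalCosetReps_iff]

/-! ### Triangularity and linear independence of the x_p -/

theorem idx_of_val_eq_zero {j : Fin n} (hj : (j : ℕ) = 0) : p.idx j = 0 := by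
  obtain ⟨i, hi⟩ := p.exists_idx_eq ((Nat.zero_le _).trans_lt (p.idx_lt_length j))
  have : j ≤ i := by rw [Fin.le_def]; omega
  have := p.idx_mono this
  omega

theorem idx_succ_le {i j : Fin n} (hij : (i : ℕ) + 1 = j) : p.idx j ≤ p.idx i + 1 := by
  by_contra! h
  obtain ⟨a, ha⟩ := p.exists_idx_eq (h.trans (p.idx_lt_length j))
  rcases le_or_gt a i with h1 | h1
  · have := p.idx_mono h1
    omega
  · have h2 : j ≤ a := by
      rw [Fin.lt_def] at h1
      rw [Fin.le_def]
      omega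
    have := p.idx_mono h2
    omega

variable {p q} in
theorem length_le_of_idx_eq (hi : ∀ j, p.idx j = q.idx j) : p.parts.length ≤ q.parts.length := by
  by_contra! h
  obtain ⟨j, hj⟩ := p.exists_idx_eq h
  have := q.idx_lt_length j
  rw [hi] at hj
  omega

variable {p q} in
theorem ext_adjacent (hpos : ∀ j, p.isPos (p.idx j) = q.isPos (q.idx j))
    (hadj : ∀ i j : Fin n, (i : ℕ) + 1 = j → (p.idx i = p.idx j ↔ q.idx i = q.idx j)) :
    p = q := by
  have hidx : ∀ j, p.idx j = q.idx j := by
    rintro ⟨j, hj⟩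
    induction j with
    | zero => rw [p.idx_of_val_eq_zero rfl, q.idx_of_val_eq_zero rfl]
    | succ j ih =>
      have h := hadj ⟨j, by omega⟩ ⟨j + 1, hj⟩ rfl
      have h1 := p.idx_succ_le (i := ⟨j, by omega⟩) (j := ⟨j + 1, hj⟩) rfl
      have h2 := q.idx_succ_le (i := ⟨j, by omega⟩) (j := ⟨j + 1, hj⟩) rfl
      have hle : (⟨j, by omega⟩ : Fin n) ≤ ⟨j + 1, hj⟩ := Fin.mk_le_mk.2 (Nat.le_succ j)
      have h3 := p.idx_mono hle
      have h4 := q.idx_mono hle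
      have := ih (by omega)
      omega
  refine ext_idx (le_antisymm (length_le_of_idx_eq hidx)
    (length_le_of_idx_eq fun j => (hidx j).symm)) hidx fun i hi => ?_
  obtain ⟨j, rfl⟩ := p.exists_idx_eq hi
  rw [hpos, hidx]

/-- The positions in positive blocks. -/
def posPositions : Finset (Fin n) := {j | p.isPos (p.idx j) = true}

open scoped Classical in
/-- The positions that do not start a block. -/
def innerPositions : Finset (Fin n) := {j | ∃ i : Fin n, (i : ℕ) + 1 = j ∧ p.idx i = p.idx j}

theorem mem_innerPositions_iff {i j : Fin n} (hij : (i : ℕ) + 1 = j) :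
    j ∈ p.innerPositions ↔ p.idx i = p.idx j := by
  simp only [innerPositions, mem_filter, mem_univ, true_and]
  constructor
  · rintro ⟨i', h1, h2⟩
    obtain rfl : i' = i := Fin.ext (by omega)
    exact h2
  · exact fun h => ⟨i, hij, h⟩

/-- A monovariant for the relation of occurrence in `X_q`. -/
def rank : ℕ := #p.posPositions * (n + 1) + #p.innerPositions

/-- The sorting key of the canonical element of `X_p`. -/
def canonicalKey (j : Fin n) : ℤ :=
  if p.isPos (p.idx j) then (j : ℤ) - (n + 1) * p.idx j else (n + 1) * p.idx j - (j : ℤ)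

/-- An element of `X_p` that is positive exactly on the positive blocks and that descends at the
boundaries of neighbouring blocks of the same sign. -/
def canonical : W n :=
  ofPermSign (Tuple.sort p.canonicalKey).symm fun j => if p.isPos (p.idx j) then 1 else -1

theorem absPerm_canonical_lt {i j : Fin n} (h : p.canonicalKey i < p.canonicalKey j) :
    absPerm p.canonical i < absPerm p.canonical j := by
  rw [canonical, absPerm_ofPermSign]
  by_contra! hle
  have := Tuple.monotone_sort p.canonicalKey hle
  simp only [Function.comp_apply, Equiv.apply_symm_apply] at this
  omega

/-- Within one sign, values are ordered by j - (n+1)·idx j: the factor n+1 outweighs any difference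
of positions, so values rise inside a block and fall from one block to a later one. The key is
negated on negative blocks because larger absolute values are smaller there. -/
theorem val_canonical_lt {i j : Fin n} (hs : p.isPos (p.idx i) = p.isPos (p.idx j))
    (h : (i : ℤ) - (n + 1) * p.idx i < (j : ℤ) - (n + 1) * p.idx j) :
    val p.canonical i < val p.canonical j := by
  rcases hi : p.isPos (p.idx i) with _ | _
  · have hj := hs.symm.trans hi
    have := p.absPerm_canonical_lt (i := j) (j := i) (by
      simp only [canonicalKey, hi, hj, Bool.false_eq_true, if_false]
      linarith)
    rw [val_of_sgn_eq_neg_one (by simp [canonical, hi]),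
      val_of_sgn_eq_neg_one (by simp [canonical, hj])]
    rw [Fin.lt_def] at this
    omega
  · have hj := hs.symm.trans hi
    have := p.absPerm_canonical_lt (i := i) (j := j) (by
      simp only [canonicalKey, hi, hj, if_true]
      linarith)
    rw [val_of_sgn_eq_one (by simp [canonical, hi]),
      val_of_sgn_eq_one (by simp [canonical, hj])]
    rw [Fin.lt_def] at this
    omega

theorem val_canonical_pos_iff (j : Fin n) :
    0 < val p.canonical j ↔ p.isPos (p.idx j) = true := by
  rw [val_pos_iff, canonical, sgn_ofPermSign]
  rcases p.isPos (p.idx j) with _ | _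
  · simp
  · simp

theorem isAdapted_canonical : p.IsAdapted p.canonical := by
  refine ⟨fun i j h hlt => p.val_canonical_lt (by rw [h]) ?_,
    fun j hj => (p.val_canonical_pos_iff j).2 hj⟩
  rw [h]
  have : (i : ℤ) < j := by exact_mod_cast hlt
  linarith

theorem idx_eq_of_val_canonical_lt {i j : Fin n} (hij : (i : ℕ) + 1 = j)
    (hs : p.isPos (p.idx i) = p.isPos (p.idx j)) (h : val p.canonical i < val p.canonical j) :
    p.idx i = p.idx j := by
  by_contra hne
  have hle : i ≤ j := by rw [Fin.le_def]; omega
  have h1 : p.idx i + 1 ≤ p.idx j := lt_of_le_of_ne (p.idx_mono hle) hne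
  refine absurd (p.val_canonical_lt hs.symm ?_) h.not_gt
  have h2 : ((p.idx i : ℤ) + 1) ≤ p.idx j := by exact_mod_cast h1
  have h3 : ((i : ℕ) : ℤ) + 1 = (j : ℕ) := by exact_mod_cast hij
  have h4 : (n : ℤ) ≥ 1 := by have := j.pos; omega
  have := mul_le_mul_of_nonneg_left h2 (by omega : (0 : ℤ) ≤ n + 1)
  linarith

-- If the canonical element of p lies in X_q, the positive positions of q are among those of p. When
-- they coincide, so do the signs, and every joined pair of neighbours in q is joined in p. The
-- factor n+1 in `rank` makes this comparison lexicographic.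
variable {p q} in
theorem rank_lt_of_isAdapted (h : q.IsAdapted p.canonical) (hne : q ≠ p) : q.rank < p.rank := by
  have hsub : q.posPositions ⊆ p.posPositions := by
    intro j hj
    simp only [posPositions, mem_filter, mem_univ, true_and] at hj ⊢
    exact (p.val_canonical_pos_iff j).1 (h.2 j hj)
  have hA : #q.innerPositions ≤ n := (Finset.card_le_univ _).trans_eq (Fintype.card_fin n)
  rcases hsub.eq_or_ssubset with heq | hss
  · have hpos : ∀ j, q.isPos (q.idx j) = p.isPos (p.idx j) := by
      intro j
      have := Finset.ext_iff.1 heq j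
      simp only [posPositions, mem_filter, mem_univ, true_and] at this
      exact Bool.eq_iff_iff.2 this
    have hsub' : q.innerPositions ⊆ p.innerPositions := by
      intro j hj
      simp only [innerPositions, mem_filter, mem_univ, true_and] at hj ⊢
      obtain ⟨i, hij, hi⟩ := hj
      refine ⟨i, hij, p.idx_eq_of_val_canonical_lt hij ?_ (h.1 i j hi ?_)⟩
      · rw [← hpos, ← hpos, hi]
      · rw [Fin.lt_def]; omega
    rcases hsub'.eq_or_ssubset with heq' | hss'
    · refine absurd (ext_adjacent hpos fun i j hij => ?_) hne
      rw [← q.mem_innerPositions_iff hij, ← p.mem_innerPositions_iff hij, heq']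
    · rw [rank, rank, heq]
      exact Nat.add_lt_add_left (Finset.card_lt_card hss') _
  · have := Finset.card_lt_card hss
    rw [rank, rank]
    have h2 : (#q.posPositions + 1) * (n + 1) ≤ #p.posPositions * (n + 1) :=
      Nat.mul_le_mul_right _ this
    rw [add_mul] at h2
    omega

open scoped Classical in
theorem coeff_x (w : W n) : p.x.coeff w = if p.IsAdapted w then 1 else 0 := by
  rw [x_eq_sum, MonoidAlgebra.coeff_sum, Finsupp.finsetSum_apply, Finset.sum_eq_single w]
  · split_ifs <;> simp
  · intro u _ hu
    rw [MonoidAlgebra.coeff_smul, MonoidAlgebra.coeff_single, Finsupp.smul_apply,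
      Finsupp.single_eq_of_ne hu.symm, smul_zero]
  · simp

/-- Evaluate a relation at the canonical element of p: apart from p, only compositions of smaller
rank contribute, and their coefficients vanish by induction. -/
theorem linearIndependent_x : LinearIndependent ℂ (x (n := n)) := by
  classical
  rw [linearIndependent_iff']
  intro s g hg p hp
  induction h : p.rank using Nat.strong_induction_on generalizing p with
  | _ k ih =>
    have h1 := congrArg (fun a => a.coeff p.canonical) hg
    simp only [MonoidAlgebra.coeff_sum, Finsupp.finsetSum_apply, MonoidAlgebra.coeff_smul,
      Finsupp.smul_apply, coeff_x, MonoidAlgebra.coeff_zero, Finsupp.zero_apply] at h1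
    rw [Finset.sum_eq_single p] at h1
    · simpa [p.isAdapted_canonical] using h1
    · intro q hq hne
      by_cases hqa : q.IsAdapted p.canonical
      · rw [ih _ (h ▸ rank_lt_of_isAdapted hqa hne) q hq rfl, zero_smul]
      · simp [hqa]
    · exact fun hn => absurd hp hn

end SignedComposition

theorem theta_x {n : ℕ} (p : SignedComposition n) : theta n ⟨p.x, x_mem p⟩ = inducedTrivial p := by
  have h := SignedComposition.linearIndependent_x (n := n)
  have key : ∀ f : mantaciReutenauer n →ₗ[ℂ] classFunctions (W n), theta n = f →
      theta n ⟨p.x, x_mem p⟩ = f ⟨p.x, x_mem p⟩ := fun f hf => by rw [hf]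
  have hb : (⟨p.x, Submodule.subset_span ⟨p, rfl⟩⟩ : Submodule.span ℂ (Set.range
      (SignedComposition.x (n := n)))) = Module.Basis.span h p :=
    Subtype.ext (by rw [Module.Basis.span_apply])
  -- Linear independence selects the first branch of `theta`; the default value 0 never occurs.
  refine (key ((Module.Basis.span h).constr ℂ inducedTrivial) (dif_pos h)).trans ?_
  refine Eq.trans ?_ (Module.Basis.constr_basis (Module.Basis.span h) ℂ inducedTrivial p)
  rw [← hb]
  rfl

/-! ### Signed compositions as words, with multiplicative weights -/

namespace SignedComposition

variable {n : ℕ}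

/-- The word of a signed composition of `n + 1`: the sign of the first block and, for every further
position, the sign of the block that starts there or `none`. -/
def word (p : SignedComposition (n + 1)) : Bool × (Fin n → Option Bool) :=
  (p.isPos 0, fun i => if p.idx i.castSucc = p.idx i.succ then none
    else some (p.isPos (p.idx i.succ)))

theorem word_snd_eq_none_iff (p : SignedComposition (n + 1)) (i : Fin n) :
    p.word.2 i = none ↔ p.idx i.castSucc = p.idx i.succ := by
  simp [word]

theorem idx_zero (p : SignedComposition (n + 1)) : p.idx 0 = 0 := p.idx_of_val_eq_zero rfl

theorem exists_castSucc_succ {i j : Fin (n + 1)} (hij : (i : ℕ) + 1 = j) :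
    ∃ k : Fin n, i = k.castSucc ∧ j = k.succ :=
  ⟨⟨i, by omega⟩, rfl, Fin.ext hij.symm⟩

theorem word_injective : Function.Injective (word (n := n)) := by
  intro p q h
  have hadj : ∀ i : Fin n, p.idx i.castSucc = p.idx i.succ ↔ q.idx i.castSucc = q.idx i.succ := by
    intro i
    rw [← word_snd_eq_none_iff, ← word_snd_eq_none_iff, h]
  refine ext_adjacent (fun j => ?_) (fun i j hij => ?_)
  · induction j using Fin.induction with
    | zero =>
      rw [idx_zero, idx_zero]
      exact congrArg Prod.fst h
    | succ i ih =>
      by_cases he : p.idx i.castSucc = p.idx i.succ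
      · rw [← he, ← (hadj i).1 he, ih]
      · have h2 := congrFun (congrArg Prod.snd h) i
        simpa [word, he, mt (hadj i).2 he] using h2
  · obtain ⟨k, rfl, rfl⟩ := exists_castSucc_succ hij
    exact hadj k

theorem exists_word_eq (b : Bool) (t : Fin n → Option Bool) : ∃ p, word p = (b, t) := by
  classical
  -- The block index of position j: the number of letters other than `none` before it.
  set C : ℕ → ℕ := fun j => ∑ i ∈ range j,
    if h : i < n then (if t ⟨i, h⟩ = none then 0 else 1) else 0 with hC
  have hstep : ∀ i : Fin n, C (i + 1) = C i + if t i = none then 0 else 1 := by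
    intro i
    simp only [hC, Finset.sum_range_succ, i.2, dif_pos]
  have hmono : Monotone C := monotone_nat_of_le_succ fun i => by
    simp only [hC, Finset.sum_range_succ]
    exact Nat.le_add_right _ _
  have hlt : ∀ j : Fin (n + 1), C j < C n + 1 := fun j =>
    Nat.lt_succ_of_le (hmono (Nat.lt_succ_iff.1 j.2))
  have hsurj : ∀ j ≤ n, ∀ a ≤ C j, ∃ j' ≤ n, C j' = a := by
    intro j
    induction j with
    | zero =>
      intro _ a ha
      exact ⟨0, Nat.zero_le _, by simp only [hC, Finset.range_zero, Finset.sum_empty] at ha ⊢; omega⟩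
    | succ j ih =>
      intro hj a ha
      rcases ha.eq_or_lt with rfl | ha'
      · exact ⟨j + 1, hj, rfl⟩
      · have := hstep ⟨j, hj⟩
        simp only at this
        refine ih (by omega) a ?_
        split_ifs at this <;> omega
  obtain ⟨p, hlen, hidx, hpos⟩ := exists_of_monotone (fun j : Fin (n + 1) => ⟨C j, hlt j⟩)
    (fun i j hij => Fin.mk_le_mk.2 (hmono hij))
    (fun a => by
      obtain ⟨j, hj, hja⟩ := hsurj n le_rfl a (Nat.lt_succ_iff.1 a.2)
      exact ⟨⟨j, Nat.lt_succ_of_le hj⟩, Fin.ext hja⟩)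
    (fun a => if (a : ℕ) = 0 then b else decide (∃ i : Fin n, C (i + 1) = a ∧ t i = some true))
  refine ⟨p, Prod.ext ?_ (funext fun i => ?_)⟩
  · have := hpos 0
    simpa [word] using this
  · have h1 : p.idx i.castSucc = C i := hidx _
    have h2 : p.idx i.succ = C (i + 1) := hidx _
    have h3 := hstep i
    simp only [word, h1, h2]
    rcases hti : t i with _ | β
    · simp [h3, hti]
    · rw [hti] at h3
      simp only [reduceCtorEq, if_false] at h3
      rw [if_neg (by omega), Option.some_inj]
      have h4 := hpos ⟨C (i + 1), hlt i.succ⟩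
      simp only at h4
      rw [h4, if_neg (by omega)]
      have huniq : ∀ i' : Fin n, C (i' + 1) = C (i + 1) → t i' = some true → i' = i := by
        intro i' he ht'
        have h5 := hstep i'
        simp only [ht', reduceCtorEq, if_false] at h5
        refine Fin.ext (le_antisymm ?_ ?_)
        · by_contra! hlt'
          have : C (i + 1) ≤ C i' := hmono hlt'
          omega
        · by_contra! hlt'
          have : C (i' + 1) ≤ C i := hmono hlt'
          omega
      cases β
      · rw [decide_eq_false_iff_not]
        rintro ⟨i', he, ht'⟩
        rw [huniq i' he ht', hti] at ht'
        exact absurd ht' (by decide)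
      · exact decide_eq_true ⟨i, rfl, hti⟩

theorem word_bijective : Function.Bijective (word (n := n)) :=
  ⟨word_injective, fun ⟨b, t⟩ => exists_word_eq b t⟩

noncomputable instance : Fintype (SignedComposition (n + 1)) :=
  Fintype.ofEquiv _ (Equiv.ofBijective word word_bijective).symm

/-- The condition that a letter of the word of `p` imposes on the elements of `X_p`. -/
def LetterCond (w : W (n + 1)) (i : Fin n) : Option Bool → Prop
  | none => val w i.castSucc < val w i.succ
  | some true => 0 < val w i.succ
  | some false => True

/-- Positivity need only be tested at the start of a positive block, since w increases along the
block. This makes the condition local, one constraint per letter. -/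
theorem isAdapted_iff_word (p : SignedComposition (n + 1)) (w : W (n + 1)) :
    p.IsAdapted w ↔ (p.word.1 = true → 0 < val w 0) ∧ ∀ i, LetterCond w i (p.word.2 i) := by
  constructor
  · intro h
    refine ⟨fun h0 => h.2 0 (by rw [idx_zero]; exact h0), fun i => ?_⟩
    by_cases he : p.idx i.castSucc = p.idx i.succ
    · rw [(p.word_snd_eq_none_iff i).2 he]
      exact h.1 _ _ he Fin.castSucc_lt_succ
    · rcases hs : p.isPos (p.idx i.succ) with _ | _
      · simp [word, he, hs, LetterCond]
      · simpa [word, he, hs, LetterCond] using h.2 _ hs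
  · rintro ⟨h0, h1⟩
    have hasc : ∀ i : Fin n, p.idx i.castSucc = p.idx i.succ →
        val w i.castSucc < val w i.succ := by
      intro i he
      have := h1 i
      rwa [(p.word_snd_eq_none_iff i).2 he] at this
    refine p.isAdapted_of_adjacent (fun i j hij he => ?_) (fun j => ?_)
    · obtain ⟨k, rfl, rfl⟩ := exists_castSucc_succ hij
      exact hasc k he
    · induction j using Fin.induction with
      | zero =>
        rw [idx_zero]
        exact h0
      | succ i ih =>
        intro hs
        by_cases he : p.idx i.castSucc = p.idx i.succ
        · exact (ih (he ▸ hs)).trans (hasc i he)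
        · have := h1 i
          simpa [word, he, hs, LetterCond] using this

/-- The product of the weights of the letters of the word of `p`. -/
noncomputable def weight (α : Bool → ℂ[X]) (β : Option Bool → ℂ[X])
    (p : SignedComposition (n + 1)) : ℂ[X] :=
  α p.word.1 * ∏ i, β (p.word.2 i)

-- The sum over all words of a product of letterwise terms is the product of the sums over the
-- letters.
open scoped Classical in
theorem sum_weight (α : Bool → ℂ[X]) (β : Option Bool → ℂ[X]) (w : W (n + 1)) :
    ∑ p, (if p.IsAdapted w then weight α β p else 0) =
      (α false + if 0 < val w 0 then α true else 0) *
        ∏ i : Fin n, ((if val w i.castSucc < val w i.succ then β none else 0) +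
          (if 0 < val w i.succ then β (some true) else 0) + β (some false)) := by
  have h1 : ∀ i : Fin n, (if val w i.castSucc < val w i.succ then β none else 0) +
      (if 0 < val w i.succ then β (some true) else 0) + β (some false) =
        ∑ o, if LetterCond w i o then β o else 0 := by
    intro i
    rw [Fintype.sum_option, Fintype.sum_bool,
      show (if LetterCond w i (some false) then β (some false) else 0) = β (some false) from
        if_pos trivial]
    by_cases h1 : val w i.castSucc < val w i.succ <;> by_cases h2 : 0 < val w i.succ <;>
      simp [LetterCond, h1, h2, add_assoc]
  have h2 : (α false + if 0 < val w 0 then α true else 0) =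
      ∑ b : Bool, if (b = true → 0 < val w 0) then α b else 0 := by
    rw [Fintype.sum_bool]
    simp [add_comm]
  rw [Finset.prod_congr rfl fun i _ => h1 i, h2, Fintype.prod_sum, Finset.sum_mul_sum,
    ← Finset.sum_product']
  refine Fintype.sum_bijective word word_bijective _ _ fun p => ?_
  rw [weight, Finset.prod_ite_zero, ite_zero_mul_ite_zero]
  simp only [isAdapted_iff_word, mem_univ, true_imp_iff]

end SignedComposition

/-! ### Integration over the unit interval and Beta values -/

/-- The linear functional `f ↦ ∫₀¹ f(y) dy` on polynomials. -/
noncomputable def unitIntegral : ℂ[X] →ₗ[ℂ] ℂ :=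
  Polynomial.lsum fun k => (1 / ((k : ℂ) + 1)) • LinearMap.id

theorem unitIntegral_X_pow (k : ℕ) : unitIntegral (X ^ k) = 1 / ((k : ℂ) + 1) := by
  rw [unitIntegral, ← monomial_one_right_eq_X_pow, Polynomial.lsum_apply,
    Polynomial.sum_monomial_index _ _ (by simp)]
  simp

theorem unitIntegral_X_pow_mul_one_sub (a b : ℕ) :
    unitIntegral (X ^ a * (1 - X) ^ b) =
      (a.factorial * b.factorial : ℂ) / ((a + b + 1).factorial : ℂ) := by
  induction b generalizing a with
  | zero =>
    have h1 : (a.factorial : ℂ) ≠ 0 := by exact_mod_cast a.factorial_ne_zero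
    have h2 : (a : ℂ) + 1 ≠ 0 := by exact_mod_cast a.succ_ne_zero
    rw [pow_zero, mul_one, unitIntegral_X_pow, add_zero, Nat.factorial_succ]
    push_cast
    field_simp
    simp
  | succ b ih =>
    have : (X ^ a * (1 - X) ^ (b + 1) : ℂ[X]) = X ^ a * (1 - X) ^ b - X ^ (a + 1) * (1 - X) ^ b := by
      ring
    rw [this, map_sub, ih, ih, show a + 1 + b + 1 = a + b + 1 + 1 by ring,
      show a + (b + 1) + 1 = a + b + 1 + 1 by ring]
    have h3 : ((a + b + 1).factorial : ℂ) ≠ 0 := by exact_mod_cast Nat.factorial_ne_zero _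
    have h4 : (a : ℂ) + b + 1 + 1 ≠ 0 := by exact_mod_cast (a + b + 1).succ_ne_zero
    rw [Nat.factorial_succ (a + b + 1), Nat.factorial_succ a, Nat.factorial_succ b]
    push_cast
    field_simp
    ring

/-! ### Expansions of the Reutenauer idempotent and of its product with w₀ -/

section Expansion

variable {n : ℕ}

open SignedComposition

theorem sum_smul_x (α : Bool → ℂ[X]) (β : Option Bool → ℂ[X]) :
    ∑ p : SignedComposition (n + 1), unitIntegral (weight α β p) • p.x =
      ∑ w : W (n + 1), unitIntegral ((α false + if 0 < val w 0 then α true else 0) *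
        ∏ i : Fin n, ((if val w i.castSucc < val w i.succ then β none else 0) +
          (if 0 < val w i.succ then β (some true) else 0) + β (some false))) •
        MonoidAlgebra.single w 1 := by
  classical
  simp only [x_eq_sum, Finset.smul_sum]
  rw [Finset.sum_comm]
  refine Finset.sum_congr rfl fun w _ => ?_
  rw [← sum_weight, map_sum, Finset.sum_smul]
  refine Finset.sum_congr rfl fun p _ => ?_
  split_ifs <;> simp

/-- The weight by which `w ∈ S_m` enters the Reutenauer idempotent. -/
noncomputable def descentWeight (σ : Equiv.Perm (Fin (n + 1))) : ℂ[X] :=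
  ∏ i : Fin n, if σ i.succ < σ i.castSucc then -X else 1 - X

-- At a descent the factor is -X, elsewhere it is -X + 1. Expanding, A is the set of positions where
-- -X is chosen, and a term survives only if every descent lies in A.
open scoped Classical in
theorem descentWeight_eq_sum (σ : Equiv.Perm (Fin (n + 1))) :
    descentWeight σ = ∑ A ∈ (range n).powerset, if descents σ ⊆ A then (-X) ^ #A else 0 := by
  have h1 : descentWeight σ =
      ∏ i ∈ range n, (-X + if i ∈ descents σ then (0 : ℂ[X]) else 1) := by
    rw [Finset.prod_range, descentWeight]
    refine Finset.prod_congr rfl fun i _ => ?_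
    have : (i : ℕ) ∈ descents σ ↔ σ i.succ < σ i.castSucc :=
      ⟨fun ⟨_, h⟩ => h, fun h => ⟨by omega, h⟩⟩
    simp only [this]
    split_ifs
    · simp
    · ring
  rw [h1, Finset.prod_add]
  refine Finset.sum_congr rfl fun A hA => ?_
  have hprod : ∏ i ∈ range n \ A, (if i ∈ descents σ then (0 : ℂ[X]) else 1) =
      if descents σ ⊆ A then 1 else 0 := by
    split_ifs with h
    · refine Finset.prod_eq_one fun i hi => if_neg fun hd => ?_
      exact (Finset.mem_sdiff.1 hi).2 (h hd)
    · obtain ⟨i, hi, hiA⟩ := Set.not_subset.1 h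
      refine Finset.prod_eq_zero (i := i) ?_ (if_pos hi)
      obtain ⟨hlt, -⟩ := hi
      exact Finset.mem_sdiff.2 ⟨Finset.mem_range.2 (by omega), hiA⟩
  rw [hprod, Finset.prod_const, mul_ite, mul_one, mul_zero]

theorem reutenauer_eq_sum : reutenauer (n + 1) =
    ∑ σ, unitIntegral (descentWeight σ) • MonoidAlgebra.single (ofPerm σ) 1 := by
  classical
  have h1 : ∀ A : Finset ℕ, descentSum (n + 1) A = ∑ σ : Equiv.Perm (Fin (n + 1)),
      if descents σ ⊆ A then MonoidAlgebra.single (ofPerm σ) 1 else 0 := by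
    intro A
    rw [descentSum, ← Finset.sum_filter]
    exact Finset.sum_congr (by ext; simp) fun _ _ => rfl
  simp only [reutenauer, h1, Finset.smul_sum]
  rw [Finset.sum_comm]
  refine Finset.sum_congr rfl fun σ _ => ?_
  rw [descentWeight_eq_sum, map_sum, Finset.sum_smul]
  refine Finset.sum_congr rfl fun A _ => ?_
  split_ifs
  · congr 1
    have h2 : ((-X) ^ #A : ℂ[X]) = ((-1 : ℂ) ^ #A) • X ^ #A := by
      rw [neg_pow (X : ℂ[X]), smul_eq_C_mul]
      simp
    rw [h2, map_smul, unitIntegral_X_pow, smul_eq_mul, mul_one_div]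
  · simp

theorem ofPerm_injective : Function.Injective (ofPerm (n := n)) := by
  intro σ τ h
  simpa [ofPerm] using congrArg absPerm h

theorem val_ofPerm (σ : Equiv.Perm (Fin n)) (j : Fin n) : val (ofPerm σ) j = (σ j : ℕ) + 1 := by
  simp [val, ofPerm]

theorem val_longest_mul (w : W n) (j : Fin n) : val (longest n * w) j = -val w j := by
  simp [val, longest]

theorem exists_eq_ofPerm {w : W n} (h : ∀ j, 0 < val w j) : ∃ σ, ofPerm σ = w := by
  refine ⟨absPerm w, ext_coord (by simp [ofPerm]) (funext fun j => ?_)⟩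
  rw [(val_pos_iff w j).1 (h j)]
  simp [ofPerm]

theorem longest_mul_longest : longest n * longest n = 1 :=
  ext_coord (by simp [longest]) (funext fun j => by simp [longest])

/-- The expansion of the Reutenauer idempotent in the basis `x_p`. -/
theorem reutenauer_eq_sum_x : reutenauer (n + 1) = ∑ p : SignedComposition (n + 1),
    unitIntegral (weight (fun b => if b then 1 else 0)
      (fun o => o.elim 1 fun b => if b then -X else 0) p) • p.x := by
  rw [sum_smul_x, reutenauer_eq_sum]
  refine Fintype.sum_of_injective ofPerm ofPerm_injective _ _ (fun w hw => ?_) (fun σ => ?_)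
  · have hz : ∀ f : ℂ[X], f = 0 → unitIntegral f • MonoidAlgebra.single w (1 : ℂ) = 0 := by
      rintro f rfl
      simp
    refine hz _ ?_
    by_cases h0 : 0 < val w 0
    -- A positive first entry together with some negative entry forces a passage from positive to
    -- negative. It is neither an ascent nor positive at its end, so its factor is 0.
    · have hex : ∃ i : Fin n, 0 < val w i.castSucc ∧ ¬ 0 < val w i.succ := by
        by_contra! hcon
        refine hw (exists_eq_ofPerm fun j => ?_)
        induction j using Fin.induction with
        | zero => exact h0
        | succ i ih => exact hcon i ih
      obtain ⟨i, h1, h2⟩ := hex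
      have h3 : ¬ val w i.castSucc < val w i.succ := by omega
      exact mul_eq_zero_of_right _ (Finset.prod_eq_zero (mem_univ i) (by simp [h2, h3]))
    · simp [h0]
  · congr 2
    have hp : ∀ j, 0 < val (ofPerm σ) j := fun j => by rw [val_ofPerm]; omega
    simp only [hp, if_true, Option.elim, Bool.false_eq_true, if_false, zero_add, one_mul,
      add_zero, descentWeight]
    refine Finset.prod_congr rfl fun i _ => ?_
    have hne : σ i.castSucc ≠ σ i.succ := fun e =>
      Fin.castSucc_lt_succ.ne (σ.injective e)
    have h1 : val (ofPerm σ) i.castSucc < val (ofPerm σ) i.succ ↔ ¬ σ i.succ < σ i.castSucc := by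
      rw [val_ofPerm, val_ofPerm, not_lt, hne.le_iff_lt, Fin.lt_def]
      omega
    simp only [h1]
    split_ifs <;> ring

/-- The expansion of the product of the longest element and the Reutenauer idempotent in the basis
`x_p`. -/
theorem longest_mul_reutenauer_eq_sum_x :
    MonoidAlgebra.single (longest (n + 1)) 1 * reutenauer (n + 1) =
      ∑ p : SignedComposition (n + 1), unitIntegral (weight (fun b => if b then -1 else 1)
      (fun o => o.elim (-1) fun b => if b then X else 1 - X) p) • p.x := by
  rw [sum_smul_x, reutenauer_eq_sum, Finset.mul_sum]
  refine Fintype.sum_of_injective (fun σ => longest (n + 1) * ofPerm σ)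
    ((mul_right_injective _).comp ofPerm_injective) _ _ (fun w hw => ?_) (fun σ => ?_)
  · have hz : ∀ f : ℂ[X], f = 0 → unitIntegral f • MonoidAlgebra.single w (1 : ℂ) = 0 := by
      rintro f rfl
      simp
    refine hz _ ?_
    by_cases h0 : 0 < val w 0
    · simp [h0]
    -- A passage from negative to positive is an ascent ending at a positive value; its factor is -1
    -- + X + (1 - X) = 0.
    · have hex : ∃ i : Fin n, ¬ 0 < val w i.castSucc ∧ 0 < val w i.succ := by
        by_contra! hcon
        have hneg : ∀ j, ¬ 0 < val w j := by
          intro j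
          induction j using Fin.induction with
          | zero => exact h0
          | succ i ih => exact not_lt.2 (hcon i (not_lt.1 ih))
        obtain ⟨σ, hσ⟩ := exists_eq_ofPerm (w := longest (n + 1) * w) fun j => by
          have := hneg j
          have := val_ne_zero w j
          rw [val_longest_mul]
          omega
        refine hw ⟨σ, ?_⟩
        simp only [hσ, ← mul_assoc, longest_mul_longest, one_mul]
      obtain ⟨i, h1, h2⟩ := hex
      have h3 : val w i.castSucc < val w i.succ := by omega
      exact mul_eq_zero_of_right _ (Finset.prod_eq_zero (mem_univ i) (by simp [h2, h3]))
  · rw [mul_smul_comm, MonoidAlgebra.single_mul_single, one_mul]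
    congr 2
    have hp : ∀ j, ¬ 0 < val (longest (n + 1) * ofPerm σ) j := fun j => by
      rw [val_longest_mul, val_ofPerm]; omega
    simp only [hp, if_false, Option.elim, Bool.false_eq_true, one_mul,
      add_zero, descentWeight]
    refine Finset.prod_congr rfl fun i _ => ?_
    have h1 : val (longest (n + 1) * ofPerm σ) i.castSucc <
        val (longest (n + 1) * ofPerm σ) i.succ ↔ σ i.succ < σ i.castSucc := by
      rw [val_longest_mul, val_longest_mul, val_ofPerm, val_ofPerm, Fin.lt_def]
      omega
    simp only [h1]
    split_ifs <;> ring

end Expansion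

/-! ### Weights in terms of the number and signs of the blocks -/

namespace SignedComposition

variable {n : ℕ}

/-- The signed composition `p` has `k` blocks with the signs `s`. -/
def HasSigns (p : SignedComposition n) (k : ℕ) (s : Fin k → Bool) : Prop :=
  p.parts.length = k ∧ ∀ i : Fin k, p.isPos i = s i

theorem length_pos (p : SignedComposition (n + 1)) : 0 < p.parts.length :=
  (Nat.zero_le _).trans_lt (p.idx_lt_length 0)

theorem length_le (p : SignedComposition n) : p.parts.length ≤ n := by
  have hsurj : Function.Surjective
      (fun j : Fin n => (⟨p.idx j, p.idx_lt_length j⟩ : Fin p.parts.length)) := by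
    rintro ⟨i, hi⟩
    obtain ⟨j, rfl⟩ := p.exists_idx_eq hi
    exact ⟨j, rfl⟩
  simpa using Fintype.card_le_of_surjective _ hsurj

open scoped Classical in
theorem sum_hasSigns {M : Type*} [AddCommMonoid M] (p : SignedComposition (n + 1))
    (f : ∀ k, (Fin (k + 1) → Bool) → M) (a : M) (hf : ∀ k s, p.HasSigns (k + 1) s → f k s = a) :
    ∑ k ∈ range (n + 1), ∑ s : Fin (k + 1) → Bool, (if p.HasSigns (k + 1) s then f k s else 0) =
      a := by
  obtain ⟨k, hk⟩ : ∃ k, p.parts.length = k + 1 := ⟨p.parts.length - 1, by have := p.length_pos; omega⟩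
  have hkn := p.length_le
  have ht : p.HasSigns (k + 1) fun i => p.isPos i := ⟨hk, fun _ => rfl⟩
  rw [Finset.sum_eq_single k, Finset.sum_eq_single fun i : Fin (k + 1) => p.isPos i]
  · rw [if_pos ht, hf _ _ ht]
  · intro s _ hs
    exact if_neg fun h => hs (funext fun i => (h.2 i).symm)
  · simp
  · intro l _ hl
    refine Finset.sum_eq_zero fun s _ => if_neg fun h => hl ?_
    have := h.1
    omega
  · intro h
    simp only [mem_range] at h
    omega

/-- The weight of `p` as a product over its blocks. -/
theorem weight_eq (α : Bool → ℂ[X]) (β : Option Bool → ℂ[X]) {p : SignedComposition (n + 1)}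
    {k : ℕ} {s : Fin (k + 1) → Bool} (h : p.HasSigns (k + 1) s) :
    weight α β p = α (s 0) * (β none ^ (n - k) * ∏ i : Fin k, β (some (s i.succ))) := by
  classical
  have h0 : p.word.1 = s 0 := by simpa [word] using h.2 0
  rw [weight, h0]
  congr 1
  -- The k boundaries between consecutive blocks; the index of the block on the left maps them
  -- bijectively to 0, …, k-1, and the other n-k letters are `none`.
  set S : Finset (Fin n) := {i | p.idx i.castSucc ≠ p.idx i.succ} with hS
  have hstep : ∀ i ∈ S, p.idx i.succ = p.idx i.castSucc + 1 := by
    intro i hi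
    simp only [hS, mem_filter, mem_univ, true_and] at hi
    have h1 := p.idx_succ_le (i := i.castSucc) (j := i.succ) (by simp)
    have h2 := p.idx_mono (Fin.castSucc_lt_succ (i := i)).le
    omega
  have hmaps : ∀ i ∈ S, p.idx i.castSucc < k := by
    intro i hi
    have h1 := hstep i hi
    have h2 := p.idx_lt_length i.succ
    rw [h.1] at h2
    omega
  have hinj : ∀ i ∈ S, ∀ j ∈ S, p.idx i.castSucc = p.idx j.castSucc → i = j := by
    have aux : ∀ i ∈ S, ∀ j ∈ S, p.idx i.castSucc = p.idx j.castSucc → ¬ i < j := by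
      intro i hi j hj hij hlt
      have h1 := hstep i hi
      have h2 : p.idx i.succ ≤ p.idx j.castSucc := p.idx_mono (by
        rw [Fin.le_def, Fin.val_succ, Fin.val_castSucc]
        exact hlt)
      omega
    intro i hi j hj hij
    exact le_antisymm (not_lt.1 (aux j hj i hi hij.symm)) (not_lt.1 (aux i hi j hj hij))
  have hsurj : ∀ a < k, ∃ i ∈ S, p.idx i.castSucc = a := by
    intro a ha
    by_contra! hcon
    have hle : ∀ j : Fin (n + 1), p.idx j ≤ a := by
      intro j
      induction j using Fin.induction with
      | zero => rw [idx_zero]; exact Nat.zero_le _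
      | succ i ih =>
        by_cases hi : i ∈ S
        · have := hstep i hi
          have := hcon i hi
          omega
        · simp only [hS, mem_filter, mem_univ, true_and, not_not] at hi
          omega
    obtain ⟨j, hj⟩ := p.exists_idx_eq (i := k) (by rw [h.1]; omega)
    have := hle j
    omega
  have hprod : ∀ f : ℕ → ℂ[X], ∏ i ∈ S, f (p.idx i.castSucc) = ∏ a : Fin k, f a := by
    intro f
    rw [← Finset.prod_range]
    refine Finset.prod_nbij (fun i => p.idx i.castSucc) (fun i hi => mem_range.2 (hmaps i hi))
      (fun i hi j hj => hinj i hi j hj) (fun a ha => ?_) (fun _ _ => rfl)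
    obtain ⟨i, hi, hia⟩ := hsurj a (mem_range.1 ha)
    exact ⟨i, hi, hia⟩
  have hcard : #S = k := by
    rw [← Finset.card_range k]
    refine Finset.card_nbij (fun i => p.idx i.castSucc) (fun i hi => mem_range.2 (hmaps i hi))
      (fun i hi j hj => hinj i hi j hj) (fun a ha => ?_)
    obtain ⟨i, hi, hia⟩ := hsurj a (mem_range.1 ha)
    exact ⟨i, hi, hia⟩
  rw [← Finset.prod_filter_mul_prod_filter_not univ fun i : Fin n =>
    p.idx i.castSucc ≠ p.idx i.succ, mul_comm]
  congr 1
  · rw [Finset.prod_congr rfl (g := fun _ => β none), Finset.prod_const]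
    · congr 1
      have := Finset.card_filter_add_card_filter_not (s := (univ : Finset (Fin n)))
        (fun i : Fin n => p.idx i.castSucc ≠ p.idx i.succ)
      rw [Finset.card_univ, Fintype.card_fin] at this
      have h2 : #{i : Fin n | p.idx i.castSucc ≠ p.idx i.succ} = k := hcard
      omega
    · intro i hi
      simp only [mem_filter, mem_univ, true_and, not_not] at hi
      rw [(p.word_snd_eq_none_iff i).2 hi]
  · have h2 := hprod fun a => β (some (p.isPos (a + 1)))
    have h3 : ∀ a : Fin k, p.isPos ((a : ℕ) + 1) = s a.succ := fun a => h.2 a.succ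
    simp only [h3] at h2
    rw [← h2]
    refine Finset.prod_congr rfl fun i hi => ?_
    have := hstep i hi
    simp only [hS, mem_filter, mem_univ, true_and] at hi
    rw [show p.word.2 i = some (p.isPos (p.idx i.succ)) from if_neg hi, this]

end SignedComposition

/-! ### Induced characters as counts of fixed labelings -/

-- The permutation character on G/H counts fixed cosets. The map π serves as a model of G/H inside a
-- concrete finite type; it need not be surjective, so only points of its image are counted.
open scoped Classical in
theorem induce_one_apply {G : Type*} [Group G] [Fintype G] (H : Subgroup G) {X : Type*} [Fintype X]
    (π : G → X) (hπ : ∀ g h, π g = π h ↔ g⁻¹ * h ∈ H) (v : G) :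
    (induce H 1).1 v = #{y | ∃ g, π g = y ∧ π (v⁻¹ * g) = π g} := by
  have hv : ∀ k, k⁻¹ * v * k ∈ H ↔ π (v⁻¹ * k) = π k := by
    intro k
    rw [hπ]
    simp [mul_assoc]
  have hone : ∀ x : H, (1 : classFunctions H).1 x = 1 := fun _ => rfl
  have hcount : #{k | k⁻¹ * v * k ∈ H} =
      Nat.card H * #{y | ∃ g, π g = y ∧ π (v⁻¹ * g) = π g} := by
    rw [Finset.card_eq_sum_card_fiberwise (f := π) (t := {y | ∃ g, π g = y ∧ π (v⁻¹ * g) = π g}),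
      Finset.sum_const_nat (m := Nat.card H), mul_comm]
    · intro y hy
      simp only [mem_filter, mem_univ, true_and] at hy
      obtain ⟨g, rfl, hg⟩ := hy
      rw [Nat.card_eq_fintype_card, ← Finset.card_univ]
      symm
      refine Finset.card_nbij (fun h : H => g * h) ?_ ?_ ?_
      · intro h _
        rw [← hv] at hg
        simp only [coe_filter, mem_filter, mem_univ, true_and, Set.mem_ofPred_eq]
        refine ⟨?_, ((hπ _ _).2 (by simp)).symm⟩
        have := H.mul_mem (H.mul_mem (H.inv_mem h.2) hg) h.2
        simpa [mul_assoc] using this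
      · intro a _ b _ hab
        exact Subtype.ext (mul_left_cancel hab)
      · intro k hk
        simp only [coe_filter, mem_filter, mem_univ, true_and, Set.mem_ofPred_eq] at hk
        exact ⟨⟨g⁻¹ * k, (hπ _ _).1 hk.2.symm⟩, by simp, by simp⟩
    · intro k hk
      simp only [coe_filter, mem_univ, true_and, Set.mem_ofPred_eq] at hk ⊢
      exact ⟨k, rfl, (hv k).1 hk⟩
  have hH : (Nat.card H : ℂ) ≠ 0 := by exact_mod_cast Nat.card_pos.ne'
  simp only [induce, hone, dite_eq_ite, Finset.sum_boole]
  rw [hcount]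
  push_cast
  rw [inv_mul_cancel_left₀ hH]

section Labelings

variable {n k : ℕ}

/-- A labeling of `Fin n` by `k` blocks together with signs, with the sign `1` in positive
blocks. -/
def IsLabeling (s : Fin k → Bool) (F : (Fin n → Fin k) × (Fin n → ℤˣ)) : Prop :=
  Function.Surjective F.1 ∧ ∀ j, s (F.1 j) = true → F.2 j = 1

/-- The labeling `F` is fixed by `v`. -/
def IsFixed (v : W n) (s : Fin k → Bool) (F : (Fin n → Fin k) × (Fin n → ℤˣ)) : Prop :=
  (∀ j, F.1 (absPerm v j) = F.1 j) ∧
    ∀ j, s (F.1 j) = false → F.2 (absPerm v j) * sgn v j = F.2 j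

/-- The labeling obtained from the blocks of `p` by means of `u`. -/
def pullback (p : SignedComposition n) (hp : p.parts.length = k) (u : W n) :
    (Fin n → Fin k) × (Fin n → ℤˣ) :=
  (fun j => ⟨p.idx (absPerm u j), hp ▸ p.idx_lt_length _⟩,
    fun j => if p.isPos (p.idx (absPerm u j)) then 1 else sgn u j)

/-- Pulling back along u forgets exactly left multiplication by W_p, so the inverse is needed to
describe left cosets g W_p. Signs on positive blocks are normalised to 1, since W_p changes them
freely. -/
theorem pullback_eq_iff (p : SignedComposition n) (hp : p.parts.length = k) (g h : W n) :
    pullback p hp g⁻¹ = pullback p hp h⁻¹ ↔ g⁻¹ * h ∈ p.youngSubgroup := by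
  have key : ∀ y u : W n, pullback p hp (y * u) = pullback p hp u ↔ y ∈ p.youngSubgroup := by
    intro y u
    rw [p.mem_youngSubgroup_iff]
    simp only [pullback, Prod.mk.injEq, funext_iff, Fin.mk.injEq, absPerm_mul, sgn_mul,
      Equiv.Perm.mul_apply]
    constructor
    · rintro ⟨h1, h2⟩ j
      obtain ⟨i, rfl⟩ := (absPerm u).surjective j
      refine ⟨h1 i, fun hs => ?_⟩
      have := h2 i
      rw [h1 i, hs] at this
      simpa using this
    · intro hy
      refine ⟨fun j => (hy _).1, fun j => ?_⟩
      rw [(hy _).1]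
      rcases hs : p.isPos (p.idx (absPerm u j)) with _ | _
      · simp [(hy _).2 hs]
      · simp
  have := key (g⁻¹ * h) h⁻¹
  rwa [mul_inv_cancel_right] at this

theorem isFixed_pullback_iff {p : SignedComposition n} {s : Fin k → Bool} (hp : p.HasSigns k s)
    (v u : W n) :
    pullback p hp.1 (u * v) = pullback p hp.1 u ↔ IsFixed v s (pullback p hp.1 u) := by
  have hs : ∀ j, s (⟨p.idx j, hp.1 ▸ p.idx_lt_length _⟩) = p.isPos (p.idx j) :=
    fun j => (hp.2 _).symm
  simp only [IsFixed, pullback, Prod.mk.injEq, funext_iff, Fin.mk.injEq, absPerm_mul, sgn_mul,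
    Equiv.Perm.mul_apply, hs]
  refine and_congr_right fun h1 => forall_congr' fun j => ?_
  rw [h1]
  rcases p.isPos (p.idx (absPerm u j)) with _ | _ <;> simp

open scoped Classical in
theorem inducedTrivial_apply {p : SignedComposition n} {s : Fin k → Bool} (hp : p.HasSigns k s)
    (v : W n) : (inducedTrivial p).1 v =
      #{F | (∃ u, pullback p hp.1 u = F) ∧ IsFixed v s F} := by
  rw [inducedTrivial, induce_one_apply p.youngSubgroup (fun g => pullback p hp.1 g⁻¹)
    (pullback_eq_iff p hp.1)]
  congr 2
  ext F
  simp only [mem_filter, mem_univ, true_and, mul_inv_rev, inv_inv, isFixed_pullback_iff hp]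
  constructor
  · rintro ⟨g, rfl, hg⟩
    exact ⟨⟨_, rfl⟩, hg⟩
  · rintro ⟨⟨u, rfl⟩, hu⟩
    exact ⟨u⁻¹, by simp, by simpa using hu⟩

theorem isLabeling_pullback {p : SignedComposition n} {s : Fin k → Bool} (hp : p.HasSigns k s)
    (u : W n) : IsLabeling s (pullback p hp.1 u) := by
  constructor
  · rintro ⟨i, hi⟩
    obtain ⟨j, rfl⟩ := p.exists_idx_eq (hp.1.symm ▸ hi)
    exact ⟨(absPerm u).symm j, by simp [pullback]⟩
  · intro j hj
    rw [← hp.2] at hj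
    exact if_pos hj

/-- Sorting the positions by label makes the labels monotone, hence the block index of a
composition. -/
theorem exists_pullback_eq {s : Fin k → Bool} {F : (Fin n → Fin k) × (Fin n → ℤˣ)}
    (hF : IsLabeling s F) :
    ∃ (p : SignedComposition n) (hp : p.HasSigns k s) (u : W n), pullback p hp.1 u = F := by
  obtain ⟨p, hlen, hidx, hpos⟩ := SignedComposition.exists_of_monotone (F.1 ∘ Tuple.sort F.1)
    (Tuple.monotone_sort F.1) (hF.1.comp (Equiv.surjective _)) s
  refine ⟨p, ⟨hlen, hpos⟩, ofPermSign (Tuple.sort F.1).symm F.2, Prod.ext (funext fun j => ?_)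
    (funext fun j => ?_)⟩
  · simp [pullback, hidx]
  · simp only [pullback, absPerm_ofPermSign, sgn_ofPermSign, hidx, hpos, Function.comp_apply,
      Equiv.apply_symm_apply]
    split_ifs with h
    · exact (hF.2 j h).symm
    · rfl

theorem eq_of_pullback_eq {p q : SignedComposition n} {s : Fin k → Bool} (hp : p.HasSigns k s)
    (hq : q.HasSigns k s) {u u' : W n} (h : pullback p hp.1 u = pullback q hq.1 u') : p = q := by
  have h1 : ∀ j, p.idx (absPerm u j) = q.idx (absPerm u' j) := fun j =>
    congrArg Fin.val (congrFun (congrArg Prod.fst h) j)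
  -- Both block indices are monotone rearrangements of the same labels, and such a rearrangement is
  -- unique.
  have h2 : p.idx ∘ (1 : Equiv.Perm (Fin n)) = p.idx ∘ (absPerm u * (absPerm u')⁻¹ : _) := by
    refine Tuple.unique_monotone p.idx_mono ?_
    have : p.idx ∘ (absPerm u * (absPerm u')⁻¹ : Equiv.Perm (Fin n)) = q.idx := by
      ext j
      simp [h1]
    rw [this]
    exact q.idx_mono
  refine SignedComposition.ext_idx (hp.1.trans hq.1.symm) (fun j => ?_) fun i hi => ?_
  · have := congrFun h2 j
    simpa [h1] using this
  · rw [hp.1] at hi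
    exact (hp.2 ⟨i, hi⟩).trans (hq.2 ⟨i, hi⟩).symm

open scoped Classical in
/-- The number of labelings with the signs `s` that are fixed by `v`. -/
noncomputable def numFixed (v : W n) (s : Fin k → Bool) : ℕ :=
  #{F : (Fin n → Fin k) × (Fin n → ℤˣ) | IsLabeling s F ∧ IsFixed v s F}

-- Each labeling with signs s comes from exactly one composition, so the sets of fixed labelings for
-- the various p partition all fixed labelings.
open scoped Classical in
theorem sum_inducedTrivial {n : ℕ} (v : W (n + 1)) (s : Fin k → Bool) :
    ∑ p : SignedComposition (n + 1), (if p.HasSigns k s then (inducedTrivial p).1 v else 0) =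
      numFixed v s := by
  set T : SignedComposition (n + 1) → Finset ((Fin (n + 1) → Fin k) × (Fin (n + 1) → ℤˣ)) :=
    fun p => {F | (∃ (hp : p.HasSigns k s) (u : W (n + 1)), pullback p hp.1 u = F) ∧ IsFixed v s F}
    with hT
  have h1 : ∀ p : SignedComposition (n + 1),
      (if p.HasSigns k s then (inducedTrivial p).1 v else 0) = (#(T p) : ℂ) := by
    intro p
    split_ifs with hp
    · rw [inducedTrivial_apply hp]
      simp [hT, hp]
    · simp [hT, hp]
  rw [Finset.sum_congr rfl fun p _ => h1 p, ← Nat.cast_sum, ← Finset.card_biUnion, numFixed]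
  · congr 2
    ext F
    simp only [hT, mem_biUnion, mem_univ, true_and, mem_filter]
    constructor
    · rintro ⟨p, ⟨hp, u, rfl⟩, hv⟩
      exact ⟨isLabeling_pullback hp u, hv⟩
    · rintro ⟨hl, hv⟩
      obtain ⟨p, hp, u, hu⟩ := exists_pullback_eq hl
      exact ⟨p, ⟨hp, u, hu⟩, hv⟩
  · intro p _ q _ hne
    refine Finset.disjoint_left.2 fun F hFp hFq => hne ?_
    simp only [hT, mem_filter, mem_univ, true_and] at hFp hFq
    obtain ⟨⟨hp, u, hu⟩, -⟩ := hFp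
    obtain ⟨⟨hq, u', hu'⟩, -⟩ := hFq
    exact eq_of_pullback_eq hp hq (hu.trans hu'.symm)

theorem sum_mul_inducedTrivial {n : ℕ} (v : W (n + 1)) (a : SignedComposition (n + 1) → ℂ)
    (f : ∀ k, (Fin (k + 1) → Bool) → ℂ)
    (hf : ∀ p k s, p.HasSigns (k + 1) s → f k s = a p) :
    ∑ p : SignedComposition (n + 1), a p * (inducedTrivial p).1 v =
      ∑ k ∈ range (n + 1), ∑ s : Fin (k + 1) → Bool, f k s * numFixed v s := by
  classical
  simp only [← sum_inducedTrivial, Finset.mul_sum]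
  rw [Finset.sum_congr rfl fun k _ => Finset.sum_comm, Finset.sum_comm]
  refine Finset.sum_congr rfl fun p _ => ?_
  rw [← p.sum_hasSigns (fun k s => f k s * (inducedTrivial p).1 v) (a p * (inducedTrivial p).1 v)
    fun k s h => by rw [hf p k s h]]
  simp only [mul_ite, mul_zero]

end Labelings

/-! ### Dependence of the count on the signs -/

section NumFixed

variable {n k : ℕ}

theorem numFixed_comp_le (v : W n) (s : Fin k → Bool) (π : Equiv.Perm (Fin k)) :
    numFixed v (s ∘ π) ≤ numFixed v s := by
  classical
  rw [numFixed, numFixed]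
  refine Finset.card_le_card_of_injOn (fun F => (π ∘ F.1, F.2)) (fun F hF => ?_) ?_
  · have h := (Finset.mem_filter.1 hF).2
    refine Finset.mem_filter.2 ⟨mem_univ _, ⟨π.surjective.comp h.1.1, h.1.2⟩, fun j => ?_, h.2.2⟩
    exact congrArg π (h.2.1 j)
  · rintro ⟨c, e⟩ _ ⟨c', e'⟩ _ h
    simp only [Prod.mk.injEq] at h ⊢
    exact ⟨(Function.Injective.comp_left π.injective) h.1, h.2⟩

theorem numFixed_comp (v : W n) (s : Fin k → Bool) (π : Equiv.Perm (Fin k)) :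
    numFixed v (s ∘ π) = numFixed v s := by
  refine le_antisymm (numFixed_comp_le v s π) ?_
  have := numFixed_comp_le v (s ∘ π) π⁻¹
  rwa [Function.comp_assoc, ← Equiv.Perm.coe_mul, mul_inv_cancel, Equiv.Perm.coe_one,
    Function.comp_id] at this

/-- Labelings impose no order on the blocks, so permuting the labels changes nothing. -/
theorem numFixed_eq_of_card (v : W n) {s t : Fin k → Bool}
    (h : #{i | s i = true} = #{i | t i = true}) : numFixed v s = numFixed v t := by
  classical
  have e : {i // s i = true} ≃ {i // t i = true} :=
    Fintype.equivOfCardEq (by rw [Fintype.card_subtype, Fintype.card_subtype, h])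
  have hs : s = t ∘ e.extendSubtype := by
    ext i
    rcases hi : s i with _ | _
    · have := e.extendSubtype_not_mem i (by simp [hi])
      simpa using this
    · exact (e.extendSubtype_mem i hi).symm
  rw [hs, numFixed_comp]

open scoped Classical in
/-- The number of surjections onto `Fin k` that are constant on the cycles of `σ`. -/
noncomputable def numInvariantSurj (σ : Equiv.Perm (Fin n)) (k : ℕ) : ℕ :=
  #{c : Fin n → Fin k | Function.Surjective c ∧ ∀ j, c (σ j) = c j}

/-- The number of choices of signs that are fixed by `v`. -/
noncomputable def numFixedSigns (v : W n) : ℕ :=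
  #{e : Fin n → ℤˣ | ∀ j, e (absPerm v j) * sgn v j = e j}

theorem numFixed_true (v : W n) :
    numFixed v (fun _ : Fin k => true) = numInvariantSurj (absPerm v) k := by
  classical
  refine Finset.card_nbij' Prod.fst (fun c => (c, 1)) ?_ ?_ ?_ ?_
  · rintro ⟨c, e⟩ h
    simp only [IsLabeling, IsFixed, coe_filter, mem_univ, true_and,
      Set.mem_ofPred_eq] at h ⊢
    exact ⟨h.1.1, h.2.1⟩
  · intro c h
    simp only [IsLabeling, IsFixed, coe_filter, mem_univ, true_and,
      Set.mem_ofPred_eq] at h ⊢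
    exact ⟨⟨h.1, fun _ _ => rfl⟩, h.2, fun _ h => absurd h (by decide)⟩
  · rintro ⟨c, e⟩ h
    simp only [IsLabeling, IsFixed, coe_filter, mem_univ, true_and,
      Set.mem_ofPred_eq] at h
    exact Prod.ext rfl (funext fun j => (h.1.2 j trivial).symm)
  · intro c _
    rfl

theorem numFixed_false (v : W n) : numFixed v (fun _ : Fin k => false) =
    numFixedSigns v * numInvariantSurj (absPerm v) k := by
  classical
  rw [mul_comm, numInvariantSurj, numFixedSigns, ← Finset.card_product, numFixed]
  congr 1
  ext ⟨c, e⟩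
  simp only [IsLabeling, IsFixed, mem_filter, mem_univ, true_and, mem_product]
  simp [and_assoc]

theorem card_filter_lt (t : ℕ) (ht : t ≤ k) :
    #{i : Fin k | decide ((i : ℕ) < t) = true} = t := by
  simp only [decide_eq_true_eq]
  rw [Fin.card_filter_val_lt, min_eq_right ht]

theorem sum_bool_card (f : ℕ → ℂ) :
    ∑ s : Fin k → Bool, f #{i | s i = true} = ∑ j ∈ range (k + 1), (k.choose j : ℂ) * f j := by
  classical
  have h1 := Finset.sum_powerset_apply_card f (x := (univ : Finset (Fin k)))
  rw [Finset.card_univ, Fintype.card_fin, Finset.powerset_univ] at h1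
  simp only [nsmul_eq_mul] at h1
  rw [← h1]
  refine Fintype.sum_bijective (fun s : Fin k → Bool => (univ.filter fun i => s i = true))
    ⟨fun s t h => ?_, fun A => ⟨fun i => decide (i ∈ A), by ext; simp⟩⟩ _ _ fun s => rfl
  ext i
  have := Finset.ext_iff.1 h i
  simpa using this

/-- Summation over the signs with Beta weights telescopes. -/
theorem sum_signs_mul_numFixed (v : W n) :
    ∑ s : Fin (k + 1) → Bool, unitIntegral ((if s 0 then -1 else 1) *
      ∏ i : Fin k, if s i.succ then X else 1 - X) * numFixed v s =
    1 / ((k : ℂ) + 1) * (numFixed v (fun _ : Fin (k + 1) => false) -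
      numFixed v (fun _ : Fin (k + 1) => true)) := by
  -- N t is the count for any sign vector with t positive entries; B t is the Beta integral of X^t
  -- (1-X)^(k-t).
  set N : ℕ → ℂ := fun t => numFixed v (fun i : Fin (k + 1) => decide ((i : ℕ) < t)) with hN
  set B : ℕ → ℂ := fun t => (t.factorial * (k - t).factorial : ℂ) / ((k + 1).factorial : ℂ) with hB
  have hnum : ∀ s : Fin (k + 1) → Bool, (numFixed v s : ℂ) = N #{i | s i = true} := by
    intro s
    simp only [hN]
    congr 1
    refine numFixed_eq_of_card v ?_
    rw [card_filter_lt _ ((Finset.card_le_univ _).trans_eq (Fintype.card_fin _))]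
  have hint : ∀ s : Fin k → Bool,
      unitIntegral (∏ i : Fin k, if s i then X else 1 - X) = B #{i | s i = true} := by
    intro s
    have h2 := Finset.card_filter_add_card_filter_not (s := (univ : Finset (Fin k)))
      (fun i => s i = true)
    rw [Finset.card_univ, Fintype.card_fin] at h2
    rw [Finset.prod_ite, Finset.prod_const, Finset.prod_const, unitIntegral_X_pow_mul_one_sub, h2]
    simp only [hB]
    congr 4
    omega
  have hB' : ∀ j ∈ range (k + 1), (k.choose j : ℂ) * B j = 1 / ((k : ℂ) + 1) := by
    intro j hj
    have h1 := Nat.choose_mul_factorial_mul_factorial (Nat.lt_succ_iff.1 (mem_range.1 hj))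
    have h2 : (k.choose j : ℂ) * j.factorial * (k - j).factorial = k.factorial := by
      exact_mod_cast h1
    have h3 : (k.factorial : ℂ) ≠ 0 := by exact_mod_cast k.factorial_ne_zero
    have h4 : (k : ℂ) + 1 ≠ 0 := by exact_mod_cast k.succ_ne_zero
    simp only [hB]
    rw [mul_div_assoc', ← mul_assoc, h2, Nat.factorial_succ]
    push_cast
    field_simp
  rw [← (Fin.consEquiv fun _ => Bool).sum_comp, Fintype.sum_prod_type, Fintype.sum_bool,
    ← Finset.sum_add_distrib]
  -- Pair the two values of the first sign over a common tail with t positive entries: the negative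
  -- one contributes N t, the positive one -N (t + 1).
  have hterm : ∀ s : Fin k → Bool,
      unitIntegral ((if (Fin.consEquiv (fun _ => Bool)) (true, s) 0 then -1 else 1) *
        ∏ i : Fin k, if (Fin.consEquiv (fun _ => Bool)) (true, s) i.succ then X else 1 - X) *
          numFixed v ((Fin.consEquiv (fun _ => Bool)) (true, s)) +
      unitIntegral ((if (Fin.consEquiv (fun _ => Bool)) (false, s) 0 then -1 else 1) *
        ∏ i : Fin k, if (Fin.consEquiv (fun _ => Bool)) (false, s) i.succ then X else 1 - X) *
          numFixed v ((Fin.consEquiv (fun _ => Bool)) (false, s)) =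
      (fun t => B t * (N t - N (t + 1))) #{i | s i = true} := by
    intro s
    rw [hnum, hnum, Fin.card_filter_univ_succ, Fin.card_filter_univ_succ]
    simp only [Fin.consEquiv_apply, Fin.cons_zero, Fin.cons_succ, if_true, Bool.false_eq_true,
      if_false, one_mul, neg_mul, map_neg, hint]
    ring
  refine (Finset.sum_congr rfl fun s _ => hterm s).trans
    ((sum_bool_card fun t => B t * (N t - N (t + 1))).trans ?_)
  simp only [← mul_assoc]
  rw [Finset.sum_congr rfl fun j hj => by rw [hB' j hj], ← Finset.mul_sum,
    Finset.sum_range_sub']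
  congr 2
  have h : (fun i : Fin (k + 1) => decide ((i : ℕ) < k + 1)) = fun _ => true := by
    ext i
    simp [i.2]
  exact congrArg (fun s => (numFixed v s : ℂ)) h

end NumFixed

/-! ### Alternating sums of surjection numbers -/

section Surjections

open scoped Classical in
/-- The number of surjections from `Fin o` to `Fin k`. -/
noncomputable def numSurj (o k : ℕ) : ℕ := #{f : Fin o → Fin k | Function.Surjective f}

theorem numSurj_eq_zero_of_lt {o k : ℕ} (h : o < k) : numSurj o k = 0 := by
  classical
  rw [numSurj, Finset.card_eq_zero, Finset.filter_eq_empty_iff]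
  intro f _ hf
  have := Fintype.card_le_of_surjective f hf
  simp only [Fintype.card_fin] at this
  omega

theorem numSurj_zero_right (o : ℕ) : numSurj o 0 = if o = 0 then 1 else 0 := by
  classical
  rcases o with _ | o
  · rw [numSurj, Finset.filter_true_of_mem fun f _ b => b.elim0]
    simp
  · rw [numSurj, Finset.card_eq_zero.2]
    · simp
    · exact Finset.eq_empty_of_forall_notMem fun f => (f 0).elim0

-- Once the first value a is fixed, the remaining map either hits a, and is surjective, or avoids a,
-- and is a surjection onto the other k points.
open scoped Classical in
theorem card_cons_surjective (o k : ℕ) (a : Fin (k + 1)) :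
    #{g : Fin o → Fin (k + 1) | Function.Surjective (Fin.cons a g : Fin (o + 1) → Fin (k + 1))} =
      numSurj o (k + 1) + numSurj o k := by
  have hsurj : ∀ g : Fin o → Fin (k + 1),
      Function.Surjective (Fin.cons a g : Fin (o + 1) → Fin (k + 1)) ↔
        ∀ y ≠ a, ∃ x, g x = y := by
    intro g
    refine forall_congr' fun y => ?_
    rw [Fin.exists_fin_succ]
    simp only [Fin.cons_zero, Fin.cons_succ, Ne, eq_comm (a := a)]
    tauto
  rw [← Finset.card_filter_add_card_filter_not (fun g => ∃ x, g x = a), Finset.filter_filter,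
    Finset.filter_filter]
  congr 1
  · rw [numSurj]
    congr 1
    ext g
    simp only [mem_filter, mem_univ, true_and, hsurj]
    constructor
    · rintro ⟨h1, h2⟩ y
      by_cases hy : y = a
      · exact hy ▸ h2
      · exact h1 y hy
    · exact fun h => ⟨fun y _ => h y, h a⟩
  · rw [numSurj]
    symm
    refine Finset.card_nbij (fun h => a.succAbove ∘ h) ?_ ?_ ?_
    · intro h hh
      simp only [mem_univ, true_and, coe_filter, Set.mem_ofPred_eq, hsurj] at hh ⊢
      refine ⟨fun y hy => ?_, ?_⟩
      · obtain ⟨z, rfl⟩ := Fin.exists_succAbove_eq hy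
        obtain ⟨x, rfl⟩ := hh z
        exact ⟨x, rfl⟩
      · rintro ⟨x, hx⟩
        exact Fin.succAbove_ne a _ hx
    · exact ((Fin.succAbove_right_injective).comp_left).injOn
    · intro g hg
      simp only [mem_univ, true_and, coe_filter, Set.mem_ofPred_eq, hsurj] at hg
      obtain ⟨h1, h2⟩ := hg
      have hex : ∀ x, ∃ z, a.succAbove z = g x := fun x =>
        Fin.exists_succAbove_eq fun e => h2 ⟨x, e⟩
      choose h hh using hex
      refine ⟨h, ?_, funext hh⟩
      simp only [mem_univ, true_and, coe_filter, Set.mem_ofPred_eq]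
      intro z
      obtain ⟨x, hx⟩ := h1 _ (Fin.succAbove_ne a z)
      exact ⟨x, Fin.succAbove_right_injective ((hh x).trans hx)⟩

theorem numSurj_succ (o k : ℕ) :
    numSurj (o + 1) (k + 1) = (k + 1) * (numSurj o (k + 1) + numSurj o k) := by
  classical
  have h1 : numSurj (o + 1) (k + 1) = ∑ a : Fin (k + 1), #{g : Fin o → Fin (k + 1) |
      Function.Surjective (Fin.cons a g : Fin (o + 1) → Fin (k + 1))} := by
    rw [numSurj, Finset.card_filter, ← (Fin.consEquiv fun _ => Fin (k + 1)).sum_comp,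
      Fintype.sum_prod_type]
    refine Finset.sum_congr rfl fun a _ => ?_
    rw [Finset.card_filter]
    rfl
  rw [h1, Finset.sum_congr rfl fun a _ => card_cons_surjective o k a]
  simp

/-- The factor k+1 in `numSurj_succ` cancels the denominator and the sum telescopes; the upper end
vanishes because o < M, the lower end is the number of surjections onto the empty set. -/
theorem sum_numSurj {o M : ℕ} (h : o < M) :
    ∑ k ∈ range M, (-1 : ℂ) ^ k / ((k : ℂ) + 1) * numSurj (o + 1) (k + 1) =
      if o = 0 then 1 else 0 := by
  have hterm : ∀ k ∈ range M, (-1 : ℂ) ^ k / ((k : ℂ) + 1) * numSurj (o + 1) (k + 1) =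
      (-1) ^ k * numSurj o k - (-1) ^ (k + 1) * numSurj o (k + 1) := by
    intro k _
    have h4 : (k : ℂ) + 1 ≠ 0 := by exact_mod_cast k.succ_ne_zero
    rw [numSurj_succ]
    push_cast
    field_simp
    ring
  rw [Finset.sum_congr rfl hterm, Finset.sum_range_sub' (fun k => (-1 : ℂ) ^ k * numSurj o k),
    numSurj_eq_zero_of_lt h, numSurj_zero_right]
  simp

variable {n : ℕ}

/-- The permutation `σ` has a single cycle. -/
def IsSingleCycle (σ : Equiv.Perm (Fin n)) : Prop := ∀ i j, σ.SameCycle i j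

theorem apply_eq_of_sameCycle {α : Type*} {σ : Equiv.Perm (Fin n)} {c : Fin n → α}
    (hc : ∀ j, c (σ j) = c j) {i j : Fin n} (h : σ.SameCycle i j) : c i = c j := by
  obtain ⟨m, -, rfl⟩ := h.exists_pow_eq'
  clear h
  induction m with
  | zero => rfl
  | succ m ih => rw [ih, pow_succ', Equiv.Perm.mul_apply, hc]

-- Maps constant on the cycles of σ are maps on the set of cycles, fixed points included.
open scoped Classical in
theorem numInvariantSurj_eq (σ : Equiv.Perm (Fin n)) (k : ℕ) :
    numInvariantSurj σ k =
      numSurj (Fintype.card (Quotient (Equiv.Perm.SameCycle.setoid σ))) k := by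
  set e := Fintype.equivFin (Quotient (Equiv.Perm.SameCycle.setoid σ))
  symm
  refine Finset.card_nbij (fun f j => f (e (Quotient.mk _ j))) ?_ ?_ ?_
  · intro f hf
    simp only [mem_univ, true_and, coe_filter, Set.mem_ofPred_eq] at hf ⊢
    refine ⟨hf.comp (e.surjective.comp Quotient.mk_surjective), fun j => ?_⟩
    rw [Quotient.sound (s := Equiv.Perm.SameCycle.setoid σ) (a := σ j) (b := j)]
    exact Equiv.Perm.sameCycle_apply_left.2 (Equiv.Perm.SameCycle.refl _ _)
  · intro f _ g _ h
    refine funext fun x => ?_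
    obtain ⟨j, hj⟩ := (e.surjective.comp Quotient.mk_surjective) x
    rw [← hj]
    exact congrFun h j
  · intro c hc
    simp only [mem_univ, true_and, coe_filter, Set.mem_ofPred_eq] at hc
    refine ⟨fun x => Quotient.lift c (fun _ _ h => apply_eq_of_sameCycle hc.2 h) (e.symm x), ?_, ?_⟩
    · simp only [mem_univ, true_and, coe_filter, Set.mem_ofPred_eq]
      intro y
      obtain ⟨j, rfl⟩ := hc.1 y
      exact ⟨e (Quotient.mk _ j), by simp⟩
    · funext j
      simp

open scoped Classical in
theorem sum_numInvariantSurj (σ : Equiv.Perm (Fin (n + 1))) :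
    ∑ k ∈ range (n + 1), (-1 : ℂ) ^ k / ((k : ℂ) + 1) * numInvariantSurj σ (k + 1) =
      if IsSingleCycle σ then 1 else 0 := by
  have hle : Fintype.card (Quotient (Equiv.Perm.SameCycle.setoid σ)) ≤ n + 1 := by
    simpa using Fintype.card_quotient_le (Equiv.Perm.SameCycle.setoid σ)
  have hpos : 0 < Fintype.card (Quotient (Equiv.Perm.SameCycle.setoid σ)) :=
    Fintype.card_pos_iff.2 ⟨Quotient.mk _ 0⟩
  have hiff : IsSingleCycle σ ↔ Fintype.card (Quotient (Equiv.Perm.SameCycle.setoid σ)) ≤ 1 := by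
    rw [Fintype.card_le_one_iff]
    constructor
    · intro h a b
      induction a using Quotient.inductionOn
      induction b using Quotient.inductionOn
      exact Quotient.sound (h _ _)
    · intro h i j
      exact Quotient.exact (h (Quotient.mk _ i) (Quotient.mk _ j))
  obtain ⟨o, ho⟩ := Nat.exists_eq_succ_of_ne_zero hpos.ne'
  simp only [numInvariantSurj_eq, hiff]
  rw [ho, sum_numSurj (by omega)]
  simp

end Surjections

/-! ### Classes of single cycles and the product of signs -/

section Conjugacy

variable {n : ℕ}

/-- The product of the signs of a signed permutation. -/
def signProd (w : W n) : ℤˣ := ∏ j, sgn w j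

theorem signProd_mul (u v : W n) : signProd (u * v) = signProd u * signProd v := by
  simp only [signProd, sgn_mul, Finset.prod_mul_distrib]
  rw [Equiv.prod_comp (absPerm v) (sgn u)]

theorem isSingleCycle_conj_iff {σ τ : Equiv.Perm (Fin n)} :
    IsSingleCycle (τ * σ * τ⁻¹) ↔ IsSingleCycle σ := by
  simp only [IsSingleCycle, Equiv.Perm.sameCycle_conj]
  constructor
  · intro h i j
    simpa using h (τ i) (τ j)
  · exact fun h i j => h _ _

theorem isSingleCycle_finRotate : IsSingleCycle (finRotate (n + 1)) := by
  rcases n with _ | n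
  · have : Subsingleton (Fin (0 + 1)) := inferInstanceAs (Subsingleton (Fin 1))
    intro i j
    rw [Subsingleton.elim i j]
  · intro i j
    have h : ∀ a : Fin (n + 2), finRotate (n + 2) a ≠ a := fun a => by
      rw [← Equiv.Perm.mem_support, support_finRotate]
      exact mem_univ a
    exact isCycle_finRotate.sameCycle (h i) (h j)

theorem isConj_finRotate {σ : Equiv.Perm (Fin (n + 1))} (hσ : IsSingleCycle σ) :
    IsConj (finRotate (n + 1)) σ := by
  rcases n with _ | n
  · have : Subsingleton (Fin (0 + 1)) := inferInstanceAs (Subsingleton (Fin 1))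
    rw [Subsingleton.elim σ (finRotate (0 + 1))]
  · have hne : ∀ a, σ a ≠ a := by
      intro a ha
      obtain ⟨b, hb⟩ := exists_ne a
      exact hb ((hσ a b).eq_of_left ha).symm
    have hcyc : σ.IsCycle := ⟨0, hne 0, fun b _ => hσ 0 b⟩
    have hsupp : σ.support = univ := by
      ext a
      simp [hne a]
    rw [Equiv.Perm.isConj_iff_cycleType_eq, cycleType_finRotate, hcyc.cycleType, hsupp]
    simp

theorem exists_mul_finRotate {t : Fin (n + 1) → ℤˣ} (ht : ∏ j, t j = 1) :
    ∃ e : Fin (n + 1) → ℤˣ, ∀ j, e (finRotate (n + 1) j) = t j * e j := by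
  -- Partial products along the cycle; total product 1 is what closes it up at the last position.
  refine ⟨fun j => ∏ i with i < j, t i, fun j => ?_⟩
  rcases eq_or_ne j (Fin.last n) with rfl | hj
  · have h1 : (univ.filter fun i : Fin (n + 1) => i < 0) = ∅ := by
      ext i
      simp
    have h2 : insert (Fin.last n) (univ.filter fun i => i < Fin.last n) = univ := by
      ext i
      simp [Fin.lt_last_iff_ne_last, em]
    beta_reduce
    have h3 := Finset.prod_insert (f := t) (a := Fin.last n)
      (s := univ.filter fun i => i < Fin.last n) (by simp)
    rw [h2, ht] at h3
    rw [finRotate_last, h1, Finset.prod_empty, h3]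
  · have hlt := Fin.lt_last_iff_ne_last.2 hj
    have hval : ((finRotate (n + 1) j : Fin (n + 1)) : ℕ) = j + 1 := coe_finRotate_of_ne_last hj
    have h2 : (univ.filter fun i => i < finRotate (n + 1) j) =
        insert j (univ.filter fun i => i < j) := by
      ext i
      simp only [mem_filter, mem_univ, true_and, mem_insert, Fin.lt_def, Fin.ext_iff, hval]
      omega
    beta_reduce
    rw [h2, Finset.prod_insert (by simp)]

theorem exists_mul_of_prod_eq_one {σ : Equiv.Perm (Fin (n + 1))} (hσ : IsSingleCycle σ)
    {t : Fin (n + 1) → ℤˣ} (ht : ∏ j, t j = 1) :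
    ∃ e : Fin (n + 1) → ℤˣ, ∀ j, e (σ j) = t j * e j := by
  obtain ⟨τ, rfl⟩ := isConj_iff.1 (isConj_finRotate hσ)
  obtain ⟨e, he⟩ := exists_mul_finRotate (t := t ∘ τ) (by
    rw [← ht]
    exact Equiv.prod_comp τ t)
  refine ⟨fun j => e (τ⁻¹ j), fun j => ?_⟩
  have := he (τ⁻¹ j)
  simpa using this

theorem isConj_of_signProd_eq {u v : W (n + 1)} (hu : IsSingleCycle (absPerm u))
    (hv : IsSingleCycle (absPerm v)) (h : signProd u = signProd v) : IsConj u v := by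
  obtain ⟨τ, hτ⟩ := isConj_iff.1 ((isConj_finRotate hu).symm.trans (isConj_finRotate hv))
  have hτ' : ∀ j, τ (absPerm u j) = absPerm v (τ j) := fun j => by simp [← hτ]
  -- After τ matches the underlying cycles, the discrepancy of the signs has product 1, so it is
  -- removed by conjugating with the sign changes e.
  obtain ⟨e, he⟩ := exists_mul_of_prod_eq_one hv (t := fun i => sgn v i * sgn u (τ⁻¹ i)) (by
    rw [Finset.prod_mul_distrib, Equiv.prod_comp τ⁻¹ (sgn u)]
    change signProd v * signProd u = 1
    rw [h, Int.units_mul_self])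
  refine isConj_iff.2 ⟨ofPermSign τ (e ∘ τ), ?_⟩
  rw [mul_inv_eq_iff_eq_mul]
  refine ext_coord ?_ (funext fun j => ?_)
  · ext j
    simp [hτ']
  · have : e (absPerm v (τ j)) = sgn v (τ j) * sgn u j * e (τ j) := by simpa using he (τ j)
    simp only [sgn_mul, sgn_ofPermSign, absPerm_ofPermSign, Function.comp_apply, hτ', this]
    rw [mul_right_comm, mul_assoc (sgn v (τ j)), Int.units_mul_self, mul_one]

theorem isConj_iff_of_isSingleCycle {u : W (n + 1)} (hu : IsSingleCycle (absPerm u))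
    (v : W (n + 1)) : IsConj u v ↔ IsSingleCycle (absPerm v) ∧ signProd v = signProd u := by
  constructor
  · intro h
    obtain ⟨c, rfl⟩ := isConj_iff.1 h
    refine ⟨?_, ?_⟩
    · simpa [isSingleCycle_conj_iff] using hu
    · have h1 : signProd c * signProd c⁻¹ = 1 := by
        rw [← signProd_mul, mul_inv_cancel]
        simp [signProd]
      rw [signProd_mul, signProd_mul, mul_right_comm, h1, one_mul]
  · exact fun h => isConj_of_signProd_eq hu h.1 h.2.symm

theorem absPerm_negCycle : absPerm (negCycle (n + 1)) = finRotate (n + 1) := by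
  rw [negCycle]
  split_ifs
  · simp [posCycle, longest, ofPerm]
  · simp

theorem signProd_posCycle : signProd (posCycle (n + 1)) = 1 := by
  simp [signProd, posCycle, ofPerm]

theorem signProd_negCycle : signProd (negCycle (n + 1)) = -1 := by
  rw [negCycle]
  split_ifs with h
  · rw [signProd_mul, signProd_posCycle, one_mul]
    simp [signProd, longest, h.neg_one_pow]
  · rw [signProd, sgn_ofPermSign, Finset.prod_eq_single (Fin.last n)]
    · simp
    · intro j _ hj
      have := Fin.lt_last_iff_ne_last.2 hj
      rw [Fin.lt_def, Fin.val_last] at this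
      exact if_neg (by omega)
    · simp

open scoped Classical in
theorem uPos_apply (v : W (n + 1)) :
    (uPos (n + 1)).1 v = if IsSingleCycle (absPerm v) ∧ signProd v = 1 then 1 else 0 := by
  have h := isConj_iff_of_isSingleCycle (u := posCycle (n + 1))
    (by simpa [posCycle, ofPerm] using isSingleCycle_finRotate) v
  rw [signProd_posCycle] at h
  simp only [uPos, classIndicator, Set.indicator_apply, Set.mem_ofPred_eq, h, Pi.one_apply]

open scoped Classical in
theorem uNeg_apply (v : W (n + 1)) :
    (uNeg (n + 1)).1 v = if IsSingleCycle (absPerm v) ∧ signProd v = -1 then 1 else 0 := by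
  have h := isConj_iff_of_isSingleCycle (u := negCycle (n + 1))
    (by rw [absPerm_negCycle]; exact isSingleCycle_finRotate) v
  rw [signProd_negCycle] at h
  simp only [uNeg, classIndicator, Set.indicator_apply, Set.mem_ofPred_eq, h, Pi.one_apply]

/-- Multiplying the fixed-point equation around the cycle forces the product of the signs to be 1.
In that case a solution exists and two solutions differ by a constant sign. -/
theorem numFixedSigns_of_isSingleCycle {v : W (n + 1)} (hv : IsSingleCycle (absPerm v)) :
    numFixedSigns v = if signProd v = 1 then 2 else 0 := by
  have hiff : ∀ e : Fin (n + 1) → ℤˣ, (∀ j, e (absPerm v j) * sgn v j = e j) ↔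
      ∀ j, e (absPerm v j) = sgn v j * e j := by
    refine fun e => forall_congr' fun j => ?_
    rw [mul_comm (sgn v j), ← mul_inv_eq_iff_eq_mul, Int.units_inv_eq_self]
  simp only [numFixedSigns, hiff]
  split_ifs with h
  · obtain ⟨e, he⟩ := exists_mul_of_prod_eq_one hv h
    rw [Finset.card_eq_two]
    refine ⟨e, -e, ?_, ?_⟩
    · intro h'
      have := congrFun h' 0
      rcases Int.units_eq_one_or (e 0) with h0 | h0 <;> simp [h0] at this
    · ext f
      simp only [mem_filter, mem_univ, true_and, mem_insert, mem_singleton]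
      constructor
      · intro hf
        have hconst : ∀ j, f j * e j = f 0 * e 0 := fun j =>
          apply_eq_of_sameCycle (c := fun j => f j * e j) (fun i => by
            rw [hf, he, mul_mul_mul_comm, Int.units_mul_self, one_mul]) (hv j 0)
        have hfj : ∀ j, f j = f 0 * e 0 * e j := fun j => by
          rw [← hconst j, mul_assoc, Int.units_mul_self, mul_one]
        rcases Int.units_eq_one_or (f 0 * e 0) with h0 | h0
        · left
          funext j
          rw [hfj, h0, one_mul]
        · right
          funext j
          rw [hfj, h0, neg_one_mul, Pi.neg_apply]
      · rintro (rfl | rfl)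
        · exact he
        · intro j
          simp [he]
  · rw [Finset.card_eq_zero, Finset.filter_eq_empty_iff]
    intro e _ he
    apply h
    have h1 : ∏ j, e (absPerm v j) = ∏ j, e j := Equiv.prod_comp (absPerm v) e
    simp only [he, Finset.prod_mul_distrib] at h1
    exact mul_eq_right.1 h1

end Conjugacy

/-! ### Evaluation of theta -/

section Theta

variable {n : ℕ}

open SignedComposition

theorem exists_theta_sum (a : SignedComposition (n + 1) → ℂ) {y : MonoidAlgebra ℂ (W (n + 1))}
    (hy : y = ∑ p, a p • p.x) : ∃ h : y ∈ mantaciReutenauer (n + 1),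
      ∀ v, (theta (n + 1) ⟨y, h⟩).1 v = ∑ p, a p * (inducedTrivial p).1 v := by
  have h : y ∈ mantaciReutenauer (n + 1) :=
    hy ▸ Submodule.sum_mem _ fun p _ => Submodule.smul_mem _ _ (x_mem p)
  refine ⟨h, fun v => ?_⟩
  have hy' : (⟨y, h⟩ : mantaciReutenauer (n + 1)) = ∑ p, a p • ⟨p.x, x_mem p⟩ :=
    Subtype.ext (by simp [hy])
  rw [hy', map_sum]
  simp only [map_smul, theta_x]
  simp

/-- The coefficient of `x_p` in the Reutenauer idempotent. -/
noncomputable def reutenauerCoeff (p : SignedComposition (n + 1)) : ℂ :=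
  unitIntegral (weight (fun b => if b then 1 else 0)
    (fun o => o.elim 1 fun b => if b then -X else 0) p)

/-- The coefficient of `x_p` in the product of the longest element and the Reutenauer
idempotent. -/
noncomputable def longestReutenauerCoeff (p : SignedComposition (n + 1)) : ℂ :=
  unitIntegral (weight (fun b => if b then -1 else 1)
    (fun o => o.elim (-1) fun b => if b then X else 1 - X) p)

open scoped Classical in
theorem sum_reutenauerCoeff (v : W (n + 1)) :
    ∑ p, reutenauerCoeff p * (inducedTrivial p).1 v =
      if IsSingleCycle (absPerm v) then 1 else 0 := by
  rw [sum_mul_inducedTrivial v reutenauerCoeff (fun k s =>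
      if s = fun _ => true then (-1 : ℂ) ^ k / ((k : ℂ) + 1) else 0),
    ← sum_numInvariantSurj]
  · refine Finset.sum_congr rfl fun k _ => ?_
    simp only [ite_mul, zero_mul, Finset.sum_ite_eq', mem_univ, if_true, numFixed_true]
  · intro p k s hs
    rw [reutenauerCoeff, weight_eq _ _ hs]
    by_cases h : s = fun _ => true
    · rw [if_pos h]
      subst h
      have h2 : ((-X) ^ k : ℂ[X]) = ((-1 : ℂ) ^ k) • X ^ k := by
        rw [neg_pow (X : ℂ[X]), smul_eq_C_mul]
        simp
      simp only [Option.elim, if_true, one_pow, one_mul, Finset.prod_const, Finset.card_univ,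
        Fintype.card_fin]
      rw [h2, map_smul, unitIntegral_X_pow, smul_eq_mul, mul_one_div]
    · obtain ⟨i, hi⟩ : ∃ i, s i = false := by
        by_contra! hcon
        exact h (funext fun i => by simpa using hcon i)
      rw [if_neg h, ← map_zero unitIntegral]
      congr 1
      symm
      rcases Fin.eq_zero_or_eq_succ i with rfl | ⟨j, rfl⟩
      · simp [hi]
      · refine mul_eq_zero_of_right _ (mul_eq_zero_of_right _
          (Finset.prod_eq_zero (mem_univ j) ?_))
        simp [hi]

open scoped Classical in
theorem sum_longestReutenauerCoeff (v : W (n + 1)) :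
    ∑ p, longestReutenauerCoeff p * (inducedTrivial p).1 v =
      (-1) ^ n * ((numFixedSigns v : ℂ) - 1) * if IsSingleCycle (absPerm v) then 1 else 0 := by
  rw [sum_mul_inducedTrivial v longestReutenauerCoeff (fun k s => (-1 : ℂ) ^ (n - k) *
      unitIntegral ((if s 0 then -1 else 1) * ∏ i : Fin k, if s i.succ then X else 1 - X)),
    ← sum_numInvariantSurj, Finset.mul_sum]
  · refine Finset.sum_congr rfl fun k hk => ?_
    simp only [mul_assoc ((-1 : ℂ) ^ (n - k))]
    rw [← Finset.mul_sum, sum_signs_mul_numFixed, numFixed_true, numFixed_false]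
    -- This turns the sign from the n-k letters `none` into the alternating sign of
    -- `sum_numInvariantSurj`.
    have h1 : (-1 : ℂ) ^ (n - k) = (-1) ^ n * (-1) ^ k := by
      rw [← pow_add]
      have hle : k ≤ n := Nat.lt_succ_iff.1 (mem_range.1 hk)
      have h2 : n + k = n - k + 2 * k := by omega
      rw [h2, pow_add, pow_mul]
      simp
    rw [h1]
    push_cast
    ring
  · intro p k s hs
    rw [longestReutenauerCoeff, weight_eq _ _ hs]
    have h2 : ((-1) ^ (n - k) : ℂ[X]) = C ((-1 : ℂ) ^ (n - k)) := by simp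
    simp only [Option.elim]
    rw [h2, mul_left_comm, ← smul_eq_C_mul, map_smul, smul_eq_mul]

end Theta

end Hyperoctahedral

open Hyperoctahedral in
theorem proposition5p2 (m : ℕ) (hm : 0 < m) :
    LinearIndependent ℂ (SignedComposition.x (n := m)) ∧
    (∀ p : SignedComposition m, theta m ⟨p.x, x_mem p⟩ = inducedTrivial p) ∧
    (∃ h : reutenauer m ∈ mantaciReutenauer m,
      theta m ⟨reutenauer m, h⟩ = uPos m + uNeg m) ∧
    (∃ h : epsPlus m * reutenauer m ∈ mantaciReutenauer m,
      theta m ⟨epsPlus m * reutenauer m, h⟩ = if Odd m then uPos m else uNeg m) ∧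
    (∃ h : epsMinus m * reutenauer m ∈ mantaciReutenauer m,
      theta m ⟨epsMinus m * reutenauer m, h⟩ = if Even m then uPos m else uNeg m) := by
  classical
  obtain ⟨n, rfl⟩ := Nat.exists_eq_succ_of_ne_zero hm.ne'
  refine ⟨SignedComposition.linearIndependent_x, theta_x, ?_, ?_, ?_⟩
  · obtain ⟨h, hθ⟩ := exists_theta_sum reutenauerCoeff (reutenauer_eq_sum_x (n := n))
    refine ⟨h, Subtype.ext (funext fun v => ?_)⟩
    rw [hθ, sum_reutenauerCoeff]
    change _ = (uPos (n + 1)).1 v + (uNeg (n + 1)).1 v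
    rw [uPos_apply, uNeg_apply]
    rcases Int.units_eq_one_or (signProd v) with hs | hs <;> simp [hs]
  · obtain ⟨h, hθ⟩ := exists_theta_sum (fun p : SignedComposition (n + 1) =>
      (1 / 2 : ℂ) * (reutenauerCoeff p + longestReutenauerCoeff p))
      (y := epsPlus (n + 1) * reutenauer (n + 1)) (by
        rw [epsPlus, smul_mul_assoc, add_mul, longest_mul_reutenauer_eq_sum_x,
          ← MonoidAlgebra.one_def, one_mul, reutenauer_eq_sum_x, ← Finset.sum_add_distrib,
          Finset.smul_sum]
        refine Finset.sum_congr rfl fun p _ => ?_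
        rw [← add_smul, smul_smul]
        rfl)
    refine ⟨h, Subtype.ext (funext fun v => ?_)⟩
    rw [hθ]
    simp only [mul_assoc, add_mul]
    rw [← Finset.mul_sum, Finset.sum_add_distrib, sum_reutenauerCoeff, sum_longestReutenauerCoeff]
    have hR : (if Odd (n + 1) then uPos (n + 1) else uNeg (n + 1)).1 v =
      if Odd (n + 1) then (uPos (n + 1)).1 v else (uNeg (n + 1)).1 v := by split_ifs <;> rfl
    rw [hR, uPos_apply, uNeg_apply]
    by_cases hc : IsSingleCycle (absPerm v)
    · rw [numFixedSigns_of_isSingleCycle hc]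
      -- On a single cycle the value is (1 + (-1)^n · `signProd v`)/2, and m = n + 1 is odd exactly
      -- when n is even.
      rcases Nat.even_or_odd n with hn | hn <;>
      rcases Int.units_eq_one_or (signProd v) with hs | hs <;>
        simp [hs, hc, hn, hn.neg_one_pow, Nat.odd_add_one] <;> norm_num
    · simp [hc]
  · obtain ⟨h, hθ⟩ := exists_theta_sum (fun p : SignedComposition (n + 1) =>
      (1 / 2 : ℂ) * (reutenauerCoeff p - longestReutenauerCoeff p))
      (y := epsMinus (n + 1) * reutenauer (n + 1)) (by
        rw [epsMinus, smul_mul_assoc, sub_mul, longest_mul_reutenauer_eq_sum_x,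
          ← MonoidAlgebra.one_def, one_mul, reutenauer_eq_sum_x, ← Finset.sum_sub_distrib,
          Finset.smul_sum]
        refine Finset.sum_congr rfl fun p _ => ?_
        rw [← sub_smul, smul_smul]
        rfl)
    refine ⟨h, Subtype.ext (funext fun v => ?_)⟩
    rw [hθ]
    simp only [mul_assoc, sub_mul]
    rw [← Finset.mul_sum, Finset.sum_sub_distrib, sum_reutenauerCoeff, sum_longestReutenauerCoeff]
    have hR : (if Even (n + 1) then uPos (n + 1) else uNeg (n + 1)).1 v =
      if Even (n + 1) then (uPos (n + 1)).1 v else (uNeg (n + 1)).1 v := by split_ifs <;> rfl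
    rw [hR, uPos_apply, uNeg_apply]
    by_cases hc : IsSingleCycle (absPerm v)
    · rw [numFixedSigns_of_isSingleCycle hc]
      rcases Nat.even_or_odd n with hn | hn <;>
      rcases Int.units_eq_one_or (signProd v) with hs | hs <;>
        simp [hs, hc, hn, hn.neg_one_pow, Nat.even_add_one] <;> norm_num
    · simp [hc]
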